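/- **Setting.** Let $k\ge 1$ and let $p,s,p_1,\dots,p_k,s_1,\dots,s_k$ be non-negative integers with $0\le p_i<p$ and $s_i\ge s\ge 0$ for all $i$. Put $\bar s=\max_i s_i$ and $N=pn+s$. Let $C_n=C_{pn+s}^{p_1n+s_1,\dots,p_kn+s_k}$ be the directed graph on $\{0,\dots,N-1\}$ with an edge $(a,b)$ whenever $b-a\equiv p_in+s_i \pmod N$ for some $i$. A *cycle cover* is a set of edges in which every vertex has indegree and outdegree $1$; $T(n)$ is the number of cycle covers of $C_n$. *Lattice graph.* Let $\widehat V(n)=\{(u,v):0\le u\le p-2,\,0\le v\le n-1\}\cup\{(p-1,v):0\le v\le n+s-1\}$ and $f(n;u,v)=un+v$. Let $\widehat E_C(n)$ be the set of pairs $((u_1,v_1),(u_2,v_2))$ in $\widehat V(n)^2$ such that for some $i$ $$\text{(a)}\quad f(n;u_2,v_2)-f(n;u_1,v_1)\equiv p_in+s_i \pmod N ,$$ and $\widehat C_n=(\widehat V(n),\widehat E_C(n))$. Let $\widehat E_L(n)$ be the set of those pairs for which some $i$ satisfies (a) and also $\text{(b)}\ u_2-u_1\equiv p_i \pmod p$ and,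 in case $p=1$, $f(n;u_1,v_1)\le f(n;u_2,v_2)$; let $L_n=(\widehat V(n),\widehat E_L(n))$. Put $\mathrm{Hook}(n)=\widehat E_C(n)\setminus\widehat E_L(n)$ and $\mathrm{New}(n)=\widehat E_L(n+1)\setminus\widehat E_L(n)$. Let $L(n)$ and $R(n)$ be the sets of the first, respectively last, $\bar s$ vertices of each row $u=0,\dots,p-1$ of $\widehat V(n)$. *Classifications.* A *legal cover* of $L_n$ is a set $T\subseteq\widehat E_L(n)$ in which all indegrees and outdegrees are at most $1$, every vertex outside $L(n)$ has indegree $1$ and every vertex outside $R(n)$ has outdegree $1$. Let $\mathcal P$ be the set of pairs $X=(L^X,R^X)$ of binary $p\bar s$-tuples. The classification $C(T)\in\mathcal P$ of a legal cover $T$ records the indegrees at the vertices $g^L(i)=(\lfloor i/\bar s\rfloor,\, i\bmod\bar s)$ of $L(n)$ and the outdegrees at the vertices $g^R(i)$ of $R(n)$, $0\le i<p\bar s$, where $g^R(i)=(u,n-1-(i\bmod \bar s))$ if $u=\lfloor i/\bar s\rfloor<p-1$ and $g^R(i)=(p-1,n+s-1-(i\bmod \bar s))$ if $\lfloor i/\bar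 s\rfloor=p-1$. Let $T_X(n)$ be the number of legal covers of $L_n$ with classification $X$, and $\bar T(n)=(T_X(n))_{X\in\mathcal P}$ (a column). *Coefficients.* Each $X\in\mathcal P$ prescribes degrees on $\widehat V(n)$: those recorded by $X$ on $L(n)$ (indegrees) and $R(n)$ (outdegrees), and $1$ elsewhere; vertices of $\widehat V(n+1)\setminus\widehat V(n)$ get degrees $0$. For $S\subseteq\mathrm{Hook}(n)$ say that *$X\cup S$ is a cycle cover* if adding the degrees in $S$ to those prescribed by $X$ gives indegree and outdegree $1$ at every vertex of $\widehat V(n)$. For $S\subseteq\mathrm{New}(n)$ say that *$C(X'\cup S)=X$* if adding the degrees in $S$ to those prescribed by $X'$ gives degrees on $\widehat V(n+1)$ that satisfy the degree conditions of a legal cover of $L_{n+1}$ and have classification $X$. Let $\beta_X(n)$ be the number of $S\subseteq\mathrm{Hook}(n)$ such that $X\cup S$ is a cycle cover, and $\alpha_{X,X'}(n)$ the number of $S\subseteq\mathrm{New}(n)$ with $C(X'\cup S)=X$. **Theorem.** 1. For all $n\ge0$, $T(n)$ is the permanent of the $(0,1)$ adjacency matrix of $C_n$. 2. For $n\ge 2\bar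 s$, $\beta_X(n)=\beta_X$ and $\alpha_{X,X'}(n)=\alpha_{X,X'}$ do not depend on $n$. Moreover, if $T$ is a legal cover of $L_n$ with $C(T)=X$, then for every $S\subseteq\mathrm{Hook}(n)$ the set $T\cup S$ is a cycle cover of $\widehat C_n$ if and only if $X\cup S$ is a cycle cover, and for every $S\subseteq\mathrm{New}(n)$ and $Y\in\mathcal P$ the set $T\cup S$ is a legal cover of $L_{n+1}$ with classification $Y$ if and only if $C(X\cup S)=Y$. 3. With the row vector $\beta=(\beta_X)_{X\in\mathcal P}$ and the transfer matrix $A=(\alpha_{X,X'})_{X,X'\in\mathcal P}$, for all $n\ge 2\bar s$, $$T(n)=\beta\,\bar T(n),\qquad \bar T(n+1)=A\,\bar T(n).$$ 4. Let $\mathcal P$ be ordered consistently, that is, by the lexicographic concatenation of a linear order on the left components and a linear order on the right components. Then there is a $2^{p\bar s}\times2^{p\bar s}$ matrix $\bar A$ such that $A=\mathrm{diag}(\bar A,\bar A,\dots,\bar A)$ with $2^{p\bar s}$ copies of $\bar A$ on the diagonal. 5. There are $d\le 2^{p\bar s}$ and integers $c_0,\dots,c_{d-1}$ such that $T(n+d)=\sum_{i=0}^{d-1}c_i\,T(n+i)$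 for all $n\ge 2\bar s$. -/

import Mathlib

open scoped Matrix

/-! ## Finite directed graphs given by their edge sets -/

/-- The indegree of `v` in the graph with edge set `T` (an edge `(i, j)` goes from `i` to `j`). -/
def inDeg {V : Type*} [DecidableEq V] (T : Finset (V × V)) (v : V) : ℕ :=
  (T.filter fun e => e.2 = v).card

/-- The outdegree of `v` in the graph with edge set `T`. -/
def outDeg {V : Type*} [DecidableEq V] (T : Finset (V × V)) (v : V) : ℕ :=
  (T.filter fun e => e.1 = v).card

/-- `T` is a cycle cover of the graph with vertex set `W` and edge set `E`. -/
def IsCycleCover {V : Type*} [DecidableEq V] (W : Finset V) (E T : Finset (V × V)) : Prop :=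
  T ⊆ E ∧ ∀ v ∈ W, inDeg T v = 1 ∧ outDeg T v = 1

/-- The parameters of the family `C_{pn+s}` with jumps `p_i n + s_i`, `i = 1, …, k`. -/
structure LinearJumps where
  /-- the number of jumps -/
  k : ℕ
  p : ℕ
  s : ℕ
  /-- the slopes `p_i` -/
  pj : Fin k → ℕ
  /-- the offsets `s_i` -/
  sj : Fin k → ℕ

namespace LinearJumps

variable (J : LinearJumps)

/-- The normalization `0 ≤ p_i < p` and `s_i ≥ s ≥ 0`; there is at least one jump. -/
def Normalized : Prop :=
  0 < J.k ∧ (∀ i, J.pj i < J.p) ∧ ∀ i, J.s ≤ J.sj i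

/-- `s̄`, the largest offset. -/
def sbar : ℕ := Finset.univ.sup J.sj

/-! ## The circulant graph `C_n` -/

/-- The number `pn + s` of vertices. -/
def size (n : ℕ) : ℕ := J.p * n + J.s

/-- The edges of `C_n`, on the vertices `0, …, pn + s - 1`: `j - i` is one of the jumps
modulo `pn + s`. -/
def circEdges (n : ℕ) : Finset (ℕ × ℕ) :=
  (Finset.range (J.size n) ×ˢ Finset.range (J.size n)).filter fun e =>
    ∃ i : Fin J.k, (e.2 : ℤ) - (e.1 : ℤ) ≡ ((J.pj i * n + J.sj i : ℕ) : ℤ) [ZMOD (J.size n : ℤ)]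

open Classical in
/-- `T(n)`, the number of cycle covers of `C_n`. -/
noncomputable def numCycleCovers (n : ℕ) : ℕ :=
  ((J.circEdges n).powerset.filter fun T =>
    IsCycleCover (Finset.range (J.size n)) (J.circEdges n) T).card

/-- The `(0,1)` circulant adjacency matrix of `C_n`. -/
def circMatrix (n : ℕ) : Matrix (Fin (J.size n)) (Fin (J.size n)) ℕ :=
  Matrix.of fun i j => if ((i : ℕ), (j : ℕ)) ∈ J.circEdges n then 1 else 0

/-! ## The same graph drawn on a lattice, and the lattice graph `L_n` -/

/-- The lattice vertices: rows `0, …, p - 2` have length `n`, row `p - 1` has length `n + s`. -/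
def latVerts (n : ℕ) : Finset (ℕ × ℕ) :=
  (Finset.range J.p ×ˢ Finset.range (n + J.s)).filter fun x => x.1 + 1 < J.p → x.2 < n

/-- The number `un + v` of the lattice vertex `(u, v)`. -/
def label (n : ℕ) (x : ℕ × ℕ) : ℕ := x.1 * n + x.2

/-- The edges of the circulant graph on the lattice vertices. -/
def latCircEdges (n : ℕ) : Finset ((ℕ × ℕ) × (ℕ × ℕ)) :=
  (J.latVerts n ×ˢ J.latVerts n).filter fun e =>
    ∃ i : Fin J.k, (label n e.2 : ℤ) - (label n e.1 : ℤ) ≡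
      ((J.pj i * n + J.sj i : ℕ) : ℤ) [ZMOD (J.size n : ℤ)]

/-- The edges of the lattice graph `L_n`: the jump `i` that produces the edge also accounts for
the change of row. For `p = 1` there is only one row and the condition on rows is void; there
the lattice graph consists of the edges that do not wrap around, as is usual for constant
jumps. -/
def latEdges (n : ℕ) : Finset ((ℕ × ℕ) × (ℕ × ℕ)) :=
  (J.latVerts n ×ˢ J.latVerts n).filter fun e =>
    ∃ i : Fin J.k,
      (label n e.2 : ℤ) - (label n e.1 : ℤ) ≡
        ((J.pj i * n + J.sj i : ℕ) : ℤ) [ZMOD (J.size n : ℤ)] ∧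
      (e.2.1 : ℤ) - (e.1.1 : ℤ) ≡ (J.pj i : ℤ) [ZMOD (J.p : ℤ)] ∧
      (J.p = 1 → label n e.1 ≤ label n e.2)

/-- `Hook(n)`. -/
def hook (n : ℕ) : Finset ((ℕ × ℕ) × (ℕ × ℕ)) := J.latCircEdges n \ J.latEdges n

/-- `New(n)`. -/
def newEdges (n : ℕ) : Finset ((ℕ × ℕ) × (ℕ × ℕ)) := J.latEdges (n + 1) \ J.latEdges n

/-! ## Legal covers and their classification -/

/-- `L(n)` (it does not depend on `n`): the first `s̄` vertices of each row. -/
def leftVerts : Finset (ℕ × ℕ) := Finset.range J.p ×ˢ Finset.range J.sbar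

/-- `R(n)`: the last `s̄` vertices of each row (used for `n ≥ s̄`). -/
def rightVerts (n : ℕ) : Finset (ℕ × ℕ) :=
  (J.latVerts n).filter fun x =>
    (x.1 + 1 < J.p → n ≤ x.2 + J.sbar) ∧ (x.1 + 1 = J.p → n + J.s ≤ x.2 + J.sbar)

/-- Binary `p s̄`-tuples. -/
abbrev Tuple : Type := Fin (J.p * J.sbar) → Fin 2

/-- The set `𝒫` of classifications `(L, R)`. -/
abbrev Cls : Type := J.Tuple × J.Tuple

/-- The vertex of `L(n)` with index `i`. -/
def gL (i : Fin (J.p * J.sbar)) : ℕ × ℕ := ((i : ℕ) / J.sbar, (i : ℕ) % J.sbar)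

/-- The vertex of `R(n)` with index `i`. -/
def gR (n : ℕ) (i : Fin (J.p * J.sbar)) : ℕ × ℕ :=
  if (i : ℕ) / J.sbar + 1 < J.p then ((i : ℕ) / J.sbar, n - 1 - (i : ℕ) % J.sbar)
  else ((i : ℕ) / J.sbar, n + J.s - 1 - (i : ℕ) % J.sbar)

/-- The condition on indegrees `din` and outdegrees `dout` for a legal cover of `L_n`. -/
def LegalDegrees (n : ℕ) (din dout : ℕ × ℕ → ℕ) : Prop :=
  (∀ v ∈ J.latVerts n, din v ≤ 1 ∧ dout v ≤ 1) ∧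
  (∀ v ∈ J.latVerts n \ J.leftVerts, din v = 1) ∧
  (∀ v ∈ J.latVerts n \ J.rightVerts n, dout v = 1)

/-- The degrees `din`, `dout` are legal in `L_n` and their classification is `X = (L, R)`. -/
def ClassifiedAs (n : ℕ) (din dout : ℕ × ℕ → ℕ) (X : J.Cls) : Prop :=
  J.LegalDegrees n din dout ∧
  ∀ i, ((X.1 i : ℕ) = din (J.gL i)) ∧ ((X.2 i : ℕ) = dout (J.gR n i))

/-- `T` is a legal cover of `L_n` with classification `C(T) = X`. -/
def HasClass (n : ℕ) (T : Finset ((ℕ × ℕ) × (ℕ × ℕ))) (X : J.Cls) : Prop :=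
  T ⊆ J.latEdges n ∧ J.ClassifiedAs n (inDeg T) (outDeg T) X

open Classical in
/-- `T_X(n)`, the number of legal covers of `L_n` with classification `X`. -/
noncomputable def numClass (X : J.Cls) (n : ℕ) : ℕ :=
  ((J.latEdges n).powerset.filter fun T => J.HasClass n T X).card

/-! ## The coefficients `α` and `β`

A classification `X` determines all degrees of any legal cover of `L_n` with that
classification: a vertex of `L_n` has indegree `0` exactly if it is a vertex of `L(n)` at which
`X` has an entry `0`, and indegree `1` otherwise; in the same way for outdegrees and `R(n)`. So
whether `X ∪ S` is a cycle cover, and what the classification of `X ∪ S` is, makes sense for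
every `X`, even if no legal cover has that classification. -/

open Classical in
/-- The indegree of `v` in a legal cover of `L_n` with classification `X`
(`0` for vertices outside `L_n`). -/
noncomputable def clsIn (n : ℕ) (X : J.Cls) (v : ℕ × ℕ) : ℕ :=
  if v ∉ J.latVerts n ∨ ∃ i, J.gL i = v ∧ X.1 i = 0 then 0 else 1

open Classical in
/-- The outdegree of `v` in a legal cover of `L_n` with classification `X`
(`0` for vertices outside `L_n`). -/
noncomputable def clsOut (n : ℕ) (X : J.Cls) (v : ℕ × ℕ) : ℕ :=
  if v ∉ J.latVerts n ∨ ∃ i, J.gR n i = v ∧ X.2 i = 0 then 0 else 1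

/-- `X ∪ S` is a cycle cover (of the circulant graph with parameter `n`). -/
def ClosesUp (n : ℕ) (X : J.Cls) (S : Finset ((ℕ × ℕ) × (ℕ × ℕ))) : Prop :=
  ∀ v ∈ J.latVerts n, J.clsIn n X v + inDeg S v = 1 ∧ J.clsOut n X v + outDeg S v = 1

/-- `C(X' ∪ S) = X`, where `X'` refers to `L_n` and `X` to `L_{n+1}`. -/
def ExtendsTo (n : ℕ) (X' : J.Cls) (S : Finset ((ℕ × ℕ) × (ℕ × ℕ))) (X : J.Cls) : Prop :=
  J.ClassifiedAs (n + 1) (fun v => J.clsIn n X' v + inDeg S v)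
    (fun v => J.clsOut n X' v + outDeg S v) X

open Classical in
/-- `β_X`, computed with `Hook(n)`. -/
noncomputable def beta (n : ℕ) (X : J.Cls) : ℕ :=
  ((J.hook n).powerset.filter fun S => J.ClosesUp n X S).card

open Classical in
/-- `α_{X,X'}`, computed with `New(n)`. -/
noncomputable def alpha (n : ℕ) (X X' : J.Cls) : ℕ :=
  ((J.newEdges n).powerset.filter fun S => J.ExtendsTo n X' S X).card

/-- The constant row vector `β`. -/
noncomputable def betaVec : J.Cls → ℤ := fun X => (J.beta (2 * J.sbar) X : ℤ)

/-- The transfer matrix `A`. -/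
noncomputable def transferMatrix : Matrix J.Cls J.Cls ℤ :=
  Matrix.of fun X X' => (J.alpha (2 * J.sbar) X X' : ℤ)

/-- The column vector of the `T_X(n)`. -/
noncomputable def classVec (n : ℕ) : J.Cls → ℤ := fun X => (J.numClass X n : ℤ)

/-- A strict linear order on the classifications is consistent if it is the lexicographic
concatenation of strict linear orders on the left and on the right components. -/
def Consistent (lt : J.Cls → J.Cls → Prop) : Prop :=
  ∃ ltL ltR : J.Tuple → J.Tuple → Prop,
    IsStrictTotalOrder J.Tuple ltL ∧ IsStrictTotalOrder J.Tuple ltR ∧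
    ∀ X₁ X₂ : J.Cls, lt X₁ X₂ ↔ ltL X₁.1 X₂.1 ∨ (X₁.1 = X₂.1 ∧ ltR X₁.2 X₂.2)

end LinearJumps

/-! ## Counting sets of edges -/

/-! On the lattice the jump `p_i n + s_i` means: go up `p_i` rows and right `s_i` columns. Since `2
s̄ ≤ n`, the end of a row is passed at most once, and `step_cases` reduces the congruence modulo `pn
+ s` to four explicit moves. Moves that stay inside their row are described without `n`; they are
the edges of `L_n`. Moves over the end of a row are the hook edges, and they lead from `R(n)` to
`L(n)`. Since `s_i ≥ s` and `p_i < p`, a move inside a row that ends in an old vertex also starts in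
one, so every edge of `New(n)` ends in a vertex that `L_{n+1}` adds to `L_n`.

Every edge set of the circulant graph splits uniquely as `T ∪ S` with `T` in `L_n` and `S` in
`Hook(n)`; likewise for `L_{n+1}` and `New(n)`. If the union is a cycle cover (or a legal cover of
`L_{n+1}`), then `T` is legal, because `S` affects no indegree in `L_n` outside `L(n)` and no
outdegree in `L_n` outside `R(n)`. Conversely, the condition on `T ∪ S` involves `T` only through
its degrees, which the classification determines (`classifiedAs_iff`, `hasClass_iff`). Summing over
classifications gives both recursions. Translating the right ends of the rows by one column
identifies the data for `n` with those for `n + 1`, so the coefficients are constant.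

New edges never enter an old vertex, so the left component of a classification is inherited and
plays no other role (`extendsTo_iff`). Hence the transfer matrix consists of equal diagonal blocks
of size `2^(p s̄)`. Cayley–Hamilton for one block gives a recurrence shared by all the `T_X`, and
therefore by their fixed linear combination `T`. -/

open Classical in
theorem card_powerset_filter_image {α β : Type*} [DecidableEq β] {E : Finset α} {E' : Finset β}
    {φ : α → β} (hφ : Set.InjOn φ E) (hE : E.image φ = E')
    {P : Finset α → Prop} {Q : Finset β → Prop} (h : ∀ S ⊆ E, P S ↔ Q (S.image φ)) :
    (E.powerset.filter P).card = (E'.powerset.filter Q).card := by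
  subst hE
  refine Finset.card_bij (fun S _ => S.image φ) ?_ ?_ ?_
  · intro S hS
    rw [Finset.mem_filter, Finset.mem_powerset] at hS ⊢
    exact ⟨Finset.image_subset_image hS.1, (h S hS.1).1 hS.2⟩
  · intro S hS S' hS' he
    rw [Finset.mem_filter, Finset.mem_powerset] at hS hS'
    have he' : φ '' (S : Set α) = φ '' (S' : Set α) := by
      rw [← Finset.coe_image, ← Finset.coe_image]
      exact congrArg _ he
    exact Finset.coe_injective ((hφ.image_eq_image_iff
      (Finset.coe_subset.2 hS.1) (Finset.coe_subset.2 hS'.1)).1 he')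
  · intro U hU
    rw [Finset.mem_filter, Finset.mem_powerset] at hU
    obtain ⟨S, hS, rfl⟩ := Finset.subset_image_iff.1 hU.1
    refine ⟨S, ?_, rfl⟩
    rw [Finset.mem_filter, Finset.mem_powerset]
    exact ⟨hS, (h S hS).2 hU.2⟩

open Classical in
/-- If the sets `T ∪ S` with property `P` are classified by a label `x` determined by `T`, they
can be counted label by label. -/
theorem card_powerset_filter_union {α ι : Type*} [DecidableEq α] [Fintype ι]
    {E₁ E₂ E : Finset α}
    (hd : Disjoint E₁ E₂) (hE : E₁ ∪ E₂ = E) {P : Finset α → Prop} {Q R : ι → Finset α → Prop}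
    (hQ : ∀ x y T, Q x T → Q y T → x = y)
    (h : ∀ T ⊆ E₁, ∀ S ⊆ E₂, P (T ∪ S) ↔ ∃ x, Q x T ∧ R x S) :
    (E.powerset.filter P).card =
      ∑ x, (E₂.powerset.filter (R x)).card * (E₁.powerset.filter (Q x)).card := by
  have key : ∀ T ⊆ E₁, ∀ S ⊆ E₂, (T ∪ S) ∩ E₁ = T ∧ (T ∪ S) ∩ E₂ = S := by
    intro T hT S hS
    constructor
    · rw [Finset.union_inter_distrib_right, Finset.inter_eq_left.2 hT,
        Finset.disjoint_iff_inter_eq_empty.1 (hd.symm.mono_left hS), Finset.union_empty]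
    · rw [Finset.union_inter_distrib_right, Finset.inter_eq_left.2 hS,
        Finset.disjoint_iff_inter_eq_empty.1 (hd.mono_left hT), Finset.empty_union]
  have hU : E.powerset.filter P = Finset.univ.biUnion fun x =>
      ((E₂.powerset.filter (R x)) ×ˢ (E₁.powerset.filter (Q x))).image fun a => a.2 ∪ a.1 := by
    ext U
    simp only [Finset.mem_filter, Finset.mem_powerset, Finset.mem_biUnion, Finset.mem_univ,
      true_and, Finset.mem_image, Finset.mem_product, Prod.exists]
    constructor
    · rintro ⟨hUE, hP⟩
      have hUU : (U ∩ E₁) ∪ (U ∩ E₂) = U := by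
        rw [← Finset.inter_union_distrib_left, hE, Finset.inter_eq_left.2 hUE]
      have hP' := hP
      rw [← hUU, h _ Finset.inter_subset_right _ Finset.inter_subset_right] at hP'
      obtain ⟨x, hx, hx'⟩ := hP'
      exact ⟨x, _, _, ⟨⟨Finset.inter_subset_right, hx'⟩, Finset.inter_subset_right, hx⟩, hUU⟩
    · rintro ⟨x, S, T, ⟨⟨hS, hR⟩, hT, hq⟩, rfl⟩
      exact ⟨hE ▸ Finset.union_subset_union hT hS, (h T hT S hS).2 ⟨x, hq, hR⟩⟩
  rw [hU, Finset.card_biUnion]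
  · refine Finset.sum_congr rfl fun x _ => ?_
    rw [Finset.card_image_of_injOn, Finset.card_product]
    rintro ⟨S, T⟩ h1 ⟨S', T'⟩ h2 he
    simp only [Finset.coe_product, Finset.coe_filter, Finset.mem_powerset, Set.mem_prod,
      Set.mem_ofPred_eq] at h1 h2 he
    have k1 := key T h1.2.1 S h1.1.1
    have k2 := key T' h2.2.1 S' h2.1.1
    rw [he] at k1
    exact Prod.ext (k1.2.symm.trans k2.2) (k1.1.symm.trans k2.1)
  · intro x _ y _ hxy
    rw [Function.onFun, Finset.disjoint_left]
    intro U h1 h2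
    simp only [Finset.mem_image, Finset.mem_product, Finset.mem_filter, Finset.mem_powerset,
      Prod.exists] at h1 h2
    obtain ⟨S, T, ⟨⟨hS, -⟩, hT, hq⟩, rfl⟩ := h1
    obtain ⟨S', T', ⟨⟨hS', -⟩, hT', hq'⟩, he⟩ := h2
    have k1 := key T hT S hS
    have k2 := key T' hT' S' hS'
    rw [he] at k2
    have : T = T' := k1.1.symm.trans k2.1
    subst this
    exact hxy (hQ x y T hq hq')

/-! ## Degrees -/

section Degrees

variable {V W : Type*} [DecidableEq V] [DecidableEq W]

theorem inDeg_union {T S : Finset (V × V)} (h : Disjoint T S) (v : V) :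
    inDeg (T ∪ S) v = inDeg T v + inDeg S v := by
  rw [inDeg, Finset.filter_union, Finset.card_union_of_disjoint
    (Finset.disjoint_filter_filter h)]
  rfl

theorem outDeg_union {T S : Finset (V × V)} (h : Disjoint T S) (v : V) :
    outDeg (T ∪ S) v = outDeg T v + outDeg S v := by
  rw [outDeg, Finset.filter_union, Finset.card_union_of_disjoint
    (Finset.disjoint_filter_filter h)]
  rfl

theorem inDeg_eq_zero {S : Finset (V × V)} {v : V} (h : ∀ e ∈ S, e.2 ≠ v) : inDeg S v = 0 := by
  rw [inDeg, Finset.filter_false_of_mem h, Finset.card_empty]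

theorem outDeg_eq_zero {S : Finset (V × V)} {v : V} (h : ∀ e ∈ S, e.1 ≠ v) :
    outDeg S v = 0 := by
  rw [outDeg, Finset.filter_false_of_mem h, Finset.card_empty]

theorem inDeg_image {S : Finset (V × V)} {φ : V × V → W × W} (hφ : Set.InjOn φ S) {v : V} {w : W}
    (h : ∀ e ∈ S, (φ e).2 = w ↔ e.2 = v) : inDeg (S.image φ) w = inDeg S v := by
  rw [inDeg, Finset.filter_image, Finset.card_image_of_injOn
    (hφ.mono (Finset.coe_subset.2 (Finset.filter_subset _ _))), inDeg]
  exact congrArg _ (Finset.filter_congr h)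

theorem outDeg_image {S : Finset (V × V)} {φ : V × V → W × W} (hφ : Set.InjOn φ S) {v : V} {w : W}
    (h : ∀ e ∈ S, (φ e).1 = w ↔ e.1 = v) : outDeg (S.image φ) w = outDeg S v := by
  rw [outDeg, Finset.filter_image, Finset.card_image_of_injOn
    (hφ.mono (Finset.coe_subset.2 (Finset.filter_subset _ _))), outDeg]
  exact congrArg _ (Finset.filter_congr h)

theorem exists_unique_of_inDeg_eq_one {S : Finset (V × V)} {v : V} (h : inDeg S v = 1) :
    ∃ u, (u, v) ∈ S ∧ ∀ u', (u', v) ∈ S → u' = u := by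
  obtain ⟨⟨a, b⟩, he⟩ := Finset.card_eq_one.1 h
  have h1 : (a, b) ∈ S.filter fun e => e.2 = v := by rw [he]; simp
  rw [Finset.mem_filter] at h1
  obtain ⟨h1, rfl⟩ := h1
  refine ⟨a, h1, fun u' hu' => ?_⟩
  have h2 : (u', b) ∈ S.filter fun e => e.2 = b := Finset.mem_filter.2 ⟨hu', rfl⟩
  rw [he, Finset.mem_singleton] at h2
  exact congrArg Prod.fst h2

theorem exists_unique_of_outDeg_eq_one {S : Finset (V × V)} {v : V} (h : outDeg S v = 1) :
    ∃ u, (v, u) ∈ S ∧ ∀ u', (v, u') ∈ S → u' = u := by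
  obtain ⟨⟨a, b⟩, he⟩ := Finset.card_eq_one.1 h
  have h1 : (a, b) ∈ S.filter fun e => e.1 = v := by rw [he]; simp
  rw [Finset.mem_filter] at h1
  obtain ⟨h1, rfl⟩ := h1
  refine ⟨b, h1, fun u' hu' => ?_⟩
  have h2 : (a, u') ∈ S.filter fun e => e.1 = a := Finset.mem_filter.2 ⟨hu', rfl⟩
  rw [he, Finset.mem_singleton] at h2
  exact congrArg Prod.snd h2

open Classical in
theorem card_cycleCovers_image {A : Finset V} {B : Finset W} {E : Finset (V × V)}
    {E' : Finset (W × W)} (hE : E ⊆ A ×ˢ A) {f : V → W} (hf : Set.InjOn f A) (hB : A.image f = B)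
    (hE' : E.image (Prod.map f f) = E') :
    (E.powerset.filter fun T => IsCycleCover A E T).card =
      (E'.powerset.filter fun T => IsCycleCover B E' T).card := by
  have hinj : Set.InjOn (Prod.map f f) (E : Set (V × V)) := by
    intro x hx y hy hxy
    have hx' := Finset.mem_product.1 (hE hx)
    have hy' := Finset.mem_product.1 (hE hy)
    rw [Prod.map_apply', Prod.map_apply', Prod.mk.injEq] at hxy
    exact Prod.ext (hf hx'.1 hy'.1 hxy.1) (hf hx'.2 hy'.2 hxy.2)
  refine card_powerset_filter_image hinj hE' fun S hS => ?_
  have hin : ∀ v ∈ A, inDeg (S.image (Prod.map f f)) (f v) = inDeg S v := fun v hv =>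
    inDeg_image (hinj.mono (Finset.coe_subset.2 hS)) fun e he =>
      hf.eq_iff (Finset.mem_product.1 (hE (hS he))).2 hv
  have hout : ∀ v ∈ A, outDeg (S.image (Prod.map f f)) (f v) = outDeg S v := fun v hv =>
    outDeg_image (hinj.mono (Finset.coe_subset.2 hS)) fun e he =>
      hf.eq_iff (Finset.mem_product.1 (hE (hS he))).1 hv
  rw [IsCycleCover, IsCycleCover, ← hB, ← hE', Finset.forall_mem_image]
  refine and_congr (iff_of_true hS (Finset.image_subset_image hS)) (forall₂_congr fun v hv => ?_)
  rw [hin v hv, hout v hv]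

end Degrees

open Classical in
/-- The cycle covers of a graph on `Fin m` are counted by the permanent of its adjacency
matrix. -/
theorem card_cycleCovers_eq_permanent {m : ℕ} (E : Finset (Fin m × Fin m)) :
    (E.powerset.filter fun T => IsCycleCover Finset.univ E T).card =
      (Matrix.of fun i j => if (i, j) ∈ E then 1 else 0 : Matrix (Fin m) (Fin m) ℕ).permanent := by
  have hperm : (Matrix.of fun i j => if (i, j) ∈ E then 1 else 0 :
      Matrix (Fin m) (Fin m) ℕ).permanent =
      (Finset.univ.filter fun σ : Equiv.Perm (Fin m) => ∀ i, (σ i, i) ∈ E).card := by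
    -- A product of zeros and ones is the indicator that all its factors are 1.
    rw [Matrix.permanent, Finset.card_filter]
    refine Finset.sum_congr rfl fun σ _ => ?_
    simp only [Matrix.of_apply]
    rw [Finset.prod_ite_zero]
    simp
  rw [hperm]
  symm
  have hmem : ∀ (σ : Equiv.Perm (Fin m)) a b,
      (a, b) ∈ Finset.univ.image (fun i => (σ i, i)) ↔ σ b = a := by
    intro σ a b
    simp only [Finset.mem_image, Finset.mem_univ, true_and, Prod.mk.injEq]
    exact ⟨by rintro ⟨c, h1, rfl⟩; exact h1, fun h => ⟨b, h, rfl⟩⟩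
  refine Finset.card_bij (fun σ _ => Finset.univ.image fun i => (σ i, i)) ?_ ?_ ?_
  · intro σ hσ
    rw [Finset.mem_filter] at hσ
    have hsub : (Finset.univ.image fun i => (σ i, i)) ⊆ E := by
      intro e he
      obtain ⟨i, -, rfl⟩ := Finset.mem_image.1 he
      exact hσ.2 i
    refine Finset.mem_filter.2 ⟨Finset.mem_powerset.2 hsub, hsub, fun v _ => ⟨?_, ?_⟩⟩
    · refine Finset.card_eq_one.2 ⟨(σ v, v), ?_⟩
      ext ⟨a, b⟩
      rw [Finset.mem_filter, hmem, Finset.mem_singleton, Prod.mk.injEq]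
      constructor
      · rintro ⟨rfl, rfl⟩; exact ⟨rfl, rfl⟩
      · rintro ⟨rfl, rfl⟩; exact ⟨rfl, rfl⟩
    · refine Finset.card_eq_one.2 ⟨(v, σ.symm v), ?_⟩
      ext ⟨a, b⟩
      rw [Finset.mem_filter, hmem, Finset.mem_singleton, Prod.mk.injEq]
      constructor
      · rintro ⟨rfl, rfl⟩; exact ⟨rfl, (σ.symm_apply_apply b).symm⟩
      · rintro ⟨rfl, rfl⟩; exact ⟨σ.apply_symm_apply _, rfl⟩
  · intro σ _ τ _ h
    refine Equiv.ext fun i => ?_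
    have : (σ i, i) ∈ Finset.univ.image (fun i => (τ i, i)) := by
      rw [← h, hmem]
    exact ((hmem _ _ _).1 this).symm
  · intro T hT
    obtain ⟨-, hTE, hT⟩ := Finset.mem_filter.1 hT
    -- The inverse construction: `f` sends a vertex to its unique predecessor in `T`; outdegree 1
    -- makes `f` injective, hence a permutation.
    choose f hf hf' using fun v => exists_unique_of_inDeg_eq_one (hT v (Finset.mem_univ v)).1
    have hinj : Function.Injective f := by
      intro a b hab
      obtain ⟨u, -, hu⟩ := exists_unique_of_outDeg_eq_one (hT (f a) (Finset.mem_univ _)).2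
      rw [hu a (hf a), hu b (hab ▸ hf b)]
    refine ⟨Equiv.ofBijective f (Finite.injective_iff_bijective.1 hinj), ?_, ?_⟩
    · exact Finset.mem_filter.2 ⟨Finset.mem_univ _, fun i => hTE (hf i)⟩
    · ext ⟨a, b⟩
      rw [hmem]
      exact ⟨by rintro rfl; exact hf b, fun h => (hf' b a h).symm⟩

/-! ## Sequences driven by a matrix -/

/-- Every linear functional of a sequence of vectors driven by a matrix satisfies the recurrence
given by the characteristic polynomial. -/
theorem sum_charpoly_coeff_smul_eq_zero {ι : Type*} [Fintype ι] [DecidableEq ι]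
    (A : Matrix ι ι ℤ) (w : ℕ → ι → ℤ) (hw : ∀ n, w (n + 1) = A *ᵥ w n) (n : ℕ) :
    ∑ i ∈ Finset.range (Fintype.card ι + 1), A.charpoly.coeff i • w (n + i) = 0 := by
  have hpow : ∀ i, w (n + i) = (A ^ i) *ᵥ w n := by
    intro i
    induction i with
    | zero => simp
    | succ i ih => rw [← add_assoc, hw, ih, Matrix.mulVec_mulVec, pow_succ']
  have h := congrArg (fun B => B *ᵥ w n) (Matrix.aeval_self_charpoly A)
  simp only [Polynomial.aeval_eq_sum_range, Matrix.charpoly_natDegree_eq_dim,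
    Matrix.zero_mulVec, Matrix.sum_mulVec, Matrix.smul_mulVec] at h
  simpa only [hpow] using h

namespace LinearJumps

variable {J : LinearJumps}

/-! ### Elementary bounds and membership in the vertex sets -/

theorem Normalized.p_pos (hJ : J.Normalized) : 0 < J.p :=
  lt_of_le_of_lt (Nat.zero_le _) (hJ.2.1 ⟨0, hJ.1⟩)

theorem sj_le_sbar (i : Fin J.k) : J.sj i ≤ J.sbar :=
  Finset.le_sup (f := J.sj) (Finset.mem_univ i)

theorem Normalized.s_le_sbar (hJ : J.Normalized) : J.s ≤ J.sbar :=
  (hJ.2.2 ⟨0, hJ.1⟩).trans (sj_le_sbar _)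

theorem mem_latVerts {n : ℕ} {x : ℕ × ℕ} :
    x ∈ J.latVerts n ↔ x.1 < J.p ∧ x.2 < n + J.s ∧ (x.1 + 1 < J.p → x.2 < n) := by
  simp only [latVerts, Finset.mem_filter, Finset.mem_product, Finset.mem_range, and_assoc]

theorem mem_leftVerts {x : ℕ × ℕ} : x ∈ J.leftVerts ↔ x.1 < J.p ∧ x.2 < J.sbar := by
  simp only [leftVerts, Finset.mem_product, Finset.mem_range]

theorem mem_rightVerts {n : ℕ} {x : ℕ × ℕ} :
    x ∈ J.rightVerts n ↔ x ∈ J.latVerts n ∧ (x.1 + 1 < J.p → n ≤ x.2 + J.sbar) ∧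
      (x.1 + 1 = J.p → n + J.s ≤ x.2 + J.sbar) := by
  rw [rightVerts, Finset.mem_filter]

theorem leftVerts_subset_latVerts {n : ℕ} (hn : J.sbar ≤ n) : J.leftVerts ⊆ J.latVerts n := by
  intro x hx
  rw [mem_leftVerts] at hx
  rw [mem_latVerts]
  omega

theorem latVerts_subset_succ (n : ℕ) : J.latVerts n ⊆ J.latVerts (n + 1) := by
  intro x hx
  rw [mem_latVerts] at hx ⊢
  omega

/-! ## Labels -/

theorem label_lt_size {n : ℕ} {x : ℕ × ℕ} (hx : x ∈ J.latVerts n) :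
    label n x < J.size n := by
  rw [mem_latVerts] at hx
  obtain ⟨h1, h2, h3⟩ := hx
  rw [label, size]
  rcases Nat.lt_or_ge (x.1 + 1) J.p with h | h
  · have := Nat.mul_le_mul_right n h1
    rw [Nat.succ_mul] at this
    have := h3 h
    omega
  · have hp : J.p = x.1 + 1 := by omega
    rw [hp, Nat.succ_mul]
    omega

/-- Rows occupy disjoint intervals of labels: every row but the last has length exactly `n`, and
nothing follows the longer last row. -/
theorem label_injOn (n : ℕ) : Set.InjOn (label n) (J.latVerts n) := by
  have key : ∀ x ∈ J.latVerts n, ∀ y ∈ J.latVerts n, x.1 < y.1 → label n x ≠ label n y := by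
    intro x hx y hy h
    rw [mem_latVerts] at hx hy
    have h1 := Nat.mul_le_mul_right n (Nat.succ_le_of_lt h)
    rw [Nat.succ_mul] at h1
    have := hx.2.2 (by omega)
    rw [label, label]
    omega
  intro x hx y hy h
  rcases lt_trichotomy x.1 y.1 with h1 | h1 | h1
  · exact absurd h (key x hx y hy h1)
  · rw [label, label, h1] at h
    exact Prod.ext h1 (Nat.add_left_cancel h)
  · exact absurd h.symm (key y hy x hx h1)

theorem eq_of_label_modEq {n : ℕ} {x y : ℕ × ℕ} (hx : x ∈ J.latVerts n)
    (hy : y ∈ J.latVerts n) (h : (label n x : ℤ) ≡ label n y [ZMOD J.size n]) : x = y :=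
  label_injOn n hx hy (((Int.natCast_modEq_iff).1 h).eq_of_lt_of_lt
    (label_lt_size hx) (label_lt_size hy))

theorem image_label_latVerts (hJ : J.Normalized) (n : ℕ) :
    (J.latVerts n).image (label n) = Finset.range (J.size n) := by
  ext m
  rw [Finset.mem_image, Finset.mem_range]
  constructor
  · rintro ⟨x, hx, rfl⟩
    exact label_lt_size hx
  · intro hm
    have hp := hJ.p_pos
    obtain ⟨q, hq⟩ : ∃ q, J.p = q + 1 := ⟨J.p - 1, by omega⟩
    rw [size, hq, Nat.succ_mul] at hm
    -- Labels below `(p - 1) n` are located by division by `n`; the remaining ones form the last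
    -- row, which is everything when `n = 0`.
    rcases Nat.lt_or_ge m (q * n) with h | h
    · have hn : 0 < n := Nat.pos_of_ne_zero (by rintro rfl; simp at h)
      refine ⟨(m / n, m % n), ?_, ?_⟩
      · have h1 : m / n < q := Nat.div_lt_of_lt_mul (by rwa [mul_comm])
        have h2 := Nat.mod_lt m hn
        rw [mem_latVerts]
        dsimp only
        omega
      · rw [label, mul_comm]
        exact Nat.div_add_mod m n
    · refine ⟨(q, m - q * n), ?_, ?_⟩
      · rw [mem_latVerts]
        dsimp only
        omega
      · rw [label]
        dsimp only
        omega

theorem image_latCircEdges (hJ : J.Normalized) (n : ℕ) :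
    (J.latCircEdges n).image (Prod.map (label n) (label n)) = J.circEdges n := by
  ext ⟨a, b⟩
  simp only [latCircEdges, circEdges, Finset.mem_image, Finset.mem_filter, Finset.mem_product,
    ← image_label_latVerts hJ n, Prod.exists, Prod.map_apply, Prod.mk.injEq]
  constructor
  · rintro ⟨u, v, u', v', ⟨⟨h1, h2⟩, h3⟩, rfl, rfl⟩
    exact ⟨⟨⟨u, v, h1, rfl⟩, ⟨u', v', h2, rfl⟩⟩, h3⟩
  · rintro ⟨⟨⟨u, v, h1, rfl⟩, ⟨u', v', h2, rfl⟩⟩, h3⟩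
    exact ⟨u, v, u', v', ⟨⟨h1, h2⟩, h3⟩, rfl, rfl⟩

theorem latCircEdges_subset (n : ℕ) : J.latCircEdges n ⊆ J.latVerts n ×ˢ J.latVerts n :=
  Finset.filter_subset _ _

open Classical in
theorem numCycleCovers_eq (hJ : J.Normalized) (n : ℕ) :
    J.numCycleCovers n = ((J.latCircEdges n).powerset.filter fun T =>
      IsCycleCover (J.latVerts n) (J.latCircEdges n) T).card :=
  (card_cycleCovers_image (latCircEdges_subset n) (label_injOn n)
    (image_label_latVerts hJ n) (image_latCircEdges hJ n)).symm

theorem numCycleCovers_eq_permanent (n : ℕ) :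
    J.numCycleCovers n = (J.circMatrix n).permanent := by
  classical
  have hmem : ∀ a b, (a, b) ∈ J.circEdges n → a < J.size n ∧ b < J.size n := fun a b h => by
    simpa only [Finset.mem_product, Finset.mem_range] using (Finset.mem_filter.1 h).1
  -- The edge set is pulled back to `Fin (J.size n)`, where the permanent formula applies.
  rw [circMatrix, show (Matrix.of fun i j : Fin (J.size n) =>
    if ((i : ℕ), (j : ℕ)) ∈ J.circEdges n then (1 : ℕ) else 0) = Matrix.of fun i j =>
      if (i, j) ∈ Finset.univ.filter (fun e : Fin (J.size n) × Fin (J.size n) =>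
        ((e.1 : ℕ), (e.2 : ℕ)) ∈ J.circEdges n) then (1 : ℕ) else 0 from by simp,
    ← card_cycleCovers_eq_permanent, numCycleCovers]
  symm
  refine (card_cycleCovers_image (f := Fin.val) (by simp) Fin.val_injective.injOn ?_ ?_)
  · ext m
    simp only [Finset.mem_image, Finset.mem_univ, true_and, Finset.mem_range]
    exact ⟨by rintro ⟨i, rfl⟩; exact i.2, fun h => ⟨⟨m, h⟩, rfl⟩⟩
  · ext ⟨a, b⟩
    simp only [Finset.mem_image, Finset.mem_filter, Finset.mem_univ, true_and, Prod.exists,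
      Prod.map_apply, Prod.mk.injEq]
    constructor
    · rintro ⟨i, j, h, rfl, rfl⟩
      exact h
    · intro h
      exact ⟨⟨a, (hmem a b h).1⟩, ⟨b, (hmem a b h).2⟩, h, rfl, rfl⟩

/-! ## Edges that stay in their row and edges that run over the end of a row -/

/-- Some jump leads from `x` to `y` without running over the end of a row. -/
def IsLocalStep (J : LinearJumps) (x y : ℕ × ℕ) : Prop :=
  ∃ i, (y.1 = x.1 + J.pj i ∧ y.2 = x.2 + J.sj i) ∨
    (y.1 + J.p = x.1 + J.pj i ∧ y.2 + J.s = x.2 + J.sj i)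

/-- Some jump leads from `x` over the end of a row to `y`. -/
def IsHookStep (J : LinearJumps) (n : ℕ) (x y : ℕ × ℕ) : Prop :=
  ∃ i, (y.1 = x.1 + J.pj i + 1 ∧ y.2 + n = x.2 + J.sj i) ∨
    (y.1 + J.p = x.1 + J.pj i + 1 ∧ y.2 + n + J.s = x.2 + J.sj i)

/-- Each of the four moves satisfies the congruence, with quotient 0 or 1: wrapping past the last
row costs `p` rows and `s` columns, passing the end of a row trades `n` columns for one row.
Conversely, one of the four always lands on a lattice vertex, and labels are distinct modulo `pn +
s`. -/
theorem step_cases (hJ : J.Normalized) {n : ℕ} (hn : 2 * J.sbar ≤ n) {x y : ℕ × ℕ}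
    (hx : x ∈ J.latVerts n) (hy : y ∈ J.latVerts n) (i : Fin J.k) :
    (label n y : ℤ) - (label n x : ℤ) ≡ ((J.pj i * n + J.sj i : ℕ) : ℤ) [ZMOD (J.size n : ℤ)] ↔
      ((y.1 = x.1 + J.pj i ∧ y.2 = x.2 + J.sj i) ∨
        (y.1 + J.p = x.1 + J.pj i ∧ y.2 + J.s = x.2 + J.sj i)) ∨
      ((y.1 = x.1 + J.pj i + 1 ∧ y.2 + n = x.2 + J.sj i) ∨
        (y.1 + J.p = x.1 + J.pj i + 1 ∧ y.2 + n + J.s = x.2 + J.sj i)) := by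
  have hpi := hJ.2.1 i
  have hsi := hJ.2.2 i
  have hsb := sj_le_sbar i
  have back : ∀ z : ℕ × ℕ,
      (((z.1 = x.1 + J.pj i ∧ z.2 = x.2 + J.sj i) ∨
        (z.1 + J.p = x.1 + J.pj i ∧ z.2 + J.s = x.2 + J.sj i)) ∨
      ((z.1 = x.1 + J.pj i + 1 ∧ z.2 + n = x.2 + J.sj i) ∨
        (z.1 + J.p = x.1 + J.pj i + 1 ∧ z.2 + n + J.s = x.2 + J.sj i))) →
      (label n z : ℤ) - (label n x : ℤ) ≡ ((J.pj i * n + J.sj i : ℕ) : ℤ)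
        [ZMOD (J.size n : ℤ)] := by
    intro z hz
    rw [Int.modEq_iff_dvd]
    simp only [label, size]
    zify at hz
    push_cast
    rcases hz with (⟨h1, h2⟩ | ⟨h1, h2⟩) | (⟨h1, h2⟩ | ⟨h1, h2⟩)
    · exact ⟨0, by rw [h1, h2]; ring⟩
    · refine ⟨1, ?_⟩
      have h1' : (z.1 : ℤ) = x.1 + J.pj i - J.p := by linarith
      have h2' : (z.2 : ℤ) = x.2 + J.sj i - J.s := by linarith
      rw [h1', h2']; ring
    · refine ⟨0, ?_⟩
      have h2' : (z.2 : ℤ) = x.2 + J.sj i - n := by linarith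
      rw [h1, h2']; ring
    · refine ⟨1, ?_⟩
      have h1' : (z.1 : ℤ) = x.1 + J.pj i + 1 - J.p := by linarith
      have h2' : (z.2 : ℤ) = x.2 + J.sj i - J.s - n := by linarith
      rw [h1', h2']; ring
  refine ⟨fun h => ?_, back y⟩
  -- The witness depends on whether `p_i` rows up exceeds the top row and whether the column still
  -- fits. The last row has `n + s` columns, so overflowing it subtracts `n + s` and restarts in row
  -- 0.
  obtain ⟨z, hz, hzs⟩ : ∃ z ∈ J.latVerts n,
      (((z.1 = x.1 + J.pj i ∧ z.2 = x.2 + J.sj i) ∨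
        (z.1 + J.p = x.1 + J.pj i ∧ z.2 + J.s = x.2 + J.sj i)) ∨
      ((z.1 = x.1 + J.pj i + 1 ∧ z.2 + n = x.2 + J.sj i) ∨
        (z.1 + J.p = x.1 + J.pj i + 1 ∧ z.2 + n + J.s = x.2 + J.sj i))) := by
    simp only [mem_latVerts] at hx ⊢
    rcases Nat.lt_or_ge (x.1 + J.pj i) J.p with h1 | h1
    · by_cases h2 : x.2 + J.sj i < n + J.s ∧ (x.1 + J.pj i + 1 < J.p → x.2 + J.sj i < n)
      · exact ⟨(x.1 + J.pj i, x.2 + J.sj i), by dsimp only; omega, by dsimp only; omega⟩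
      · rcases Nat.lt_or_ge (x.1 + J.pj i + 1) J.p with h3 | h3
        · exact ⟨(x.1 + J.pj i + 1, x.2 + J.sj i - n), by dsimp only; omega, by dsimp only; omega⟩
        · exact ⟨(0, x.2 + J.sj i - n - J.s), by dsimp only; omega, by dsimp only; omega⟩
    · by_cases h2 : x.2 + J.sj i - J.s < n
      · exact ⟨(x.1 + J.pj i - J.p, x.2 + J.sj i - J.s), by dsimp only; omega,
          by dsimp only; omega⟩
      · exact ⟨(x.1 + J.pj i + 1 - J.p, x.2 + J.sj i - n - J.s), by dsimp only; omega,
          by dsimp only; omega⟩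
  have hyz : y = z := by
    refine eq_of_label_modEq hy hz ?_
    have := h.trans (back z hzs).symm
    simpa using this.add_right (label n x : ℤ)
  rw [hyz]
  exact hzs

theorem mem_latCircEdges (hJ : J.Normalized) {n : ℕ} (hn : 2 * J.sbar ≤ n)
    {e : (ℕ × ℕ) × (ℕ × ℕ)} :
    e ∈ J.latCircEdges n ↔ (e.1 ∈ J.latVerts n ∧ e.2 ∈ J.latVerts n) ∧
      (J.IsLocalStep e.1 e.2 ∨ J.IsHookStep n e.1 e.2) := by
  rw [latCircEdges, Finset.mem_filter, Finset.mem_product, IsLocalStep, IsHookStep, ← exists_or]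
  exact and_congr_right fun h => exists_congr fun i => step_cases hJ hn h.1 h.2 i

theorem mem_latEdges (hJ : J.Normalized) {n : ℕ} (hn : 2 * J.sbar ≤ n)
    {e : (ℕ × ℕ) × (ℕ × ℕ)} :
    e ∈ J.latEdges n ↔ (e.1 ∈ J.latVerts n ∧ e.2 ∈ J.latVerts n) ∧ J.IsLocalStep e.1 e.2 := by
  rw [latEdges, Finset.mem_filter, Finset.mem_product, IsLocalStep]
  refine and_congr_right fun h => exists_congr fun i => ?_
  rw [step_cases hJ hn h.1 h.2 i]
  have hpi := hJ.2.1 i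
  have hsi := hJ.2.2 i
  have hsb := sj_le_sbar i
  obtain ⟨hx, hy⟩ := h
  rw [mem_latVerts] at hx hy
  constructor
  · rintro ⟨h1 | h1, h2, h3⟩
    · exact h1
    · exfalso
      -- A hook move by jump `i` changes the row by `p_i + 1` modulo `p`, which differs from `p_i`
      -- unless `p = 1`; for `p = 1` it decreases the label instead.
      rcases eq_or_ne J.p 1 with hp | hp
      · have hl := h3 hp
        have hx0 : e.1.1 = 0 := by omega
        have hy0 : e.2.1 = 0 := by omega
        rw [label, label, hx0, hy0] at hl
        omega
      · have hdvd : (J.p : ℤ) ∣ 1 := by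
          rw [Int.modEq_iff_dvd] at h2
          obtain ⟨c, hc⟩ := h2
          rcases h1 with h1 | h1
          · exact ⟨-c, by rw [mul_neg, ← hc]; omega⟩
          · exact ⟨1 - c, by rw [mul_sub, ← hc]; omega⟩
        have := Int.eq_one_of_dvd_one (by omega) hdvd
        omega
  · intro h1
    refine ⟨Or.inl h1, ?_, fun hp => ?_⟩
    · rw [Int.modEq_iff_dvd]
      rcases h1 with h1 | h1
      · exact ⟨0, by omega⟩
      · exact ⟨1, by omega⟩
    · have hx0 : e.1.1 = 0 := by omega
      have hy0 : e.2.1 = 0 := by omega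
      rw [label, label, hx0, hy0]
      omega

theorem mem_hook (hJ : J.Normalized) {n : ℕ} (hn : 2 * J.sbar ≤ n) {e : (ℕ × ℕ) × (ℕ × ℕ)} :
    e ∈ J.hook n ↔ (e.1 ∈ J.latVerts n ∧ e.2 ∈ J.latVerts n) ∧ J.IsHookStep n e.1 e.2 := by
  rw [hook, Finset.mem_sdiff, mem_latCircEdges hJ hn, mem_latEdges hJ hn]
  constructor
  · tauto
  · rintro ⟨h, i, hi⟩
    refine ⟨⟨h, Or.inr ⟨i, hi⟩⟩, ?_⟩
    rintro ⟨-, j, hj⟩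
    have := hJ.2.2 i
    have := sj_le_sbar i
    have := hJ.2.2 j
    rw [mem_latVerts, mem_latVerts] at h
    omega

theorem latEdges_union_hook (n : ℕ) : J.latEdges n ∪ J.hook n = J.latCircEdges n := by
  refine Finset.union_sdiff_of_subset fun e he => ?_
  rw [latEdges, Finset.mem_filter] at he
  obtain ⟨h, i, hi, -⟩ := he
  exact Finset.mem_filter.2 ⟨h, i, hi⟩

theorem latEdges_subset_succ (hJ : J.Normalized) {n : ℕ} (hn : 2 * J.sbar ≤ n) :
    J.latEdges n ⊆ J.latEdges (n + 1) := by
  intro e he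
  rw [mem_latEdges hJ hn] at he
  rw [mem_latEdges hJ (hn.trans n.le_succ)]
  exact ⟨⟨latVerts_subset_succ n he.1.1, latVerts_subset_succ n he.1.2⟩, he.2⟩

theorem latEdges_union_newEdges (hJ : J.Normalized) {n : ℕ} (hn : 2 * J.sbar ≤ n) :
    J.latEdges n ∪ J.newEdges n = J.latEdges (n + 1) :=
  Finset.union_sdiff_of_subset (latEdges_subset_succ hJ hn)

/-- A local step does not decrease the column, and a step from a shorter row into the last row
advances by at least `s`. So an old target forces an old source, and only the newness of the target
has to be recorded. -/
theorem mem_newEdges (hJ : J.Normalized) {n : ℕ} (hn : 2 * J.sbar ≤ n)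
    {e : (ℕ × ℕ) × (ℕ × ℕ)} :
    e ∈ J.newEdges n ↔ (e.1 ∈ J.latVerts (n + 1) ∧ e.2 ∈ J.latVerts (n + 1)) ∧
      e.2 ∉ J.latVerts n ∧ J.IsLocalStep e.1 e.2 := by
  rw [newEdges, Finset.mem_sdiff, mem_latEdges hJ hn, mem_latEdges hJ (hn.trans n.le_succ)]
  constructor
  · rintro ⟨⟨h1, h2⟩, h3⟩
    refine ⟨h1, fun h4 => h3 ⟨⟨?_, h4⟩, h2⟩, h2⟩
    obtain ⟨i, hi⟩ := h2
    have := hJ.2.1 i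
    have := hJ.2.2 i
    rw [mem_latVerts] at h1 h4 ⊢
    omega
  · rintro ⟨h1, h2, h3⟩
    exact ⟨⟨h1, h3⟩, fun h => h2 h.1.2⟩

/-! ### Where hook edges and new edges attach -/

theorem snd_mem_leftVerts_of_mem_hook (hJ : J.Normalized) {n : ℕ} (hn : 2 * J.sbar ≤ n)
    {e : (ℕ × ℕ) × (ℕ × ℕ)} (he : e ∈ J.hook n) : e.2 ∈ J.leftVerts := by
  rw [mem_hook hJ hn] at he
  obtain ⟨⟨h1, h2⟩, i, hi⟩ := he
  have := hJ.2.1 i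
  have := hJ.2.2 i
  have := sj_le_sbar i
  rw [mem_latVerts] at h1 h2
  rw [mem_leftVerts]
  omega

theorem fst_mem_rightVerts_of_mem_hook (hJ : J.Normalized) {n : ℕ} (hn : 2 * J.sbar ≤ n)
    {e : (ℕ × ℕ) × (ℕ × ℕ)} (he : e ∈ J.hook n) : e.1 ∈ J.rightVerts n := by
  rw [mem_hook hJ hn] at he
  obtain ⟨⟨h1, h2⟩, i, hi⟩ := he
  have := hJ.2.1 i
  have := hJ.2.2 i
  have := sj_le_sbar i
  refine mem_rightVerts.2 ⟨h1, ?_⟩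
  rw [mem_latVerts] at h1 h2
  omega

/-- The source may itself be a new vertex, hence the condition on `e.1`. Measured from the ends of
the rows, the source is at most `s̄` columns behind; the shift by `s` in a wrapping step compensates
for the longer last row. -/
theorem fst_mem_rightVerts_of_mem_newEdges (hJ : J.Normalized) {n : ℕ} (hn : 2 * J.sbar ≤ n)
    {e : (ℕ × ℕ) × (ℕ × ℕ)} (he : e ∈ J.newEdges n) (hv : e.1 ∈ J.latVerts n) :
    e.1 ∈ J.rightVerts n := by
  rw [mem_newEdges hJ hn] at he
  obtain ⟨⟨h1, h2⟩, h3, i, hi⟩ := he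
  have := hJ.2.1 i
  have := hJ.2.2 i
  have := sj_le_sbar i
  refine mem_rightVerts.2 ⟨hv, ?_⟩
  rw [mem_latVerts] at h1 h2 h3 hv
  omega

/-! ## Classifications prescribe degrees -/

theorem gL_injective : Function.Injective J.gL := by
  intro i j h
  rw [gL, gL, Prod.mk.injEq] at h
  exact Fin.ext (by rw [← Nat.div_add_mod (i : ℕ) J.sbar, h.1, h.2, Nat.div_add_mod])

theorem index_bounds (i : Fin (J.p * J.sbar)) :
    (i : ℕ) / J.sbar < J.p ∧ (i : ℕ) % J.sbar < J.sbar := by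
  have h := i.2
  have hs : 0 < J.sbar := Nat.pos_of_mul_pos_left (lt_of_le_of_lt (Nat.zero_le _) h)
  exact ⟨Nat.div_lt_of_lt_mul (h.trans_eq (mul_comm _ _)), Nat.mod_lt _ hs⟩

theorem exists_index {a b : ℕ} (ha : a < J.p) (hb : b < J.sbar) :
    ∃ i : Fin (J.p * J.sbar), (i : ℕ) / J.sbar = a ∧ (i : ℕ) % J.sbar = b := by
  have hs : 0 < J.sbar := by omega
  have h1 := Nat.mul_le_mul_right J.sbar (Nat.succ_le_of_lt ha)
  rw [Nat.succ_mul] at h1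
  refine ⟨⟨b + a * J.sbar, by omega⟩, ?_, ?_⟩
  · dsimp only
    rw [Nat.add_mul_div_right _ _ hs, Nat.div_eq_of_lt hb, zero_add]
  · dsimp only
    rw [Nat.add_mul_mod_self_right, Nat.mod_eq_of_lt hb]

theorem mem_leftVerts_iff {x : ℕ × ℕ} : x ∈ J.leftVerts ↔ ∃ i, J.gL i = x := by
  rw [mem_leftVerts]
  constructor
  · rintro ⟨h1, h2⟩
    obtain ⟨i, hi1, hi2⟩ := exists_index h1 h2
    exact ⟨i, Prod.ext hi1 hi2⟩
  · rintro ⟨i, rfl⟩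
    exact index_bounds i

/-- With `s̄ ≤ n` the subtractions in `gR` do not truncate, so they can be replaced by sums, which
suit linear arithmetic. -/
theorem gR_spec {n : ℕ} (hn : J.sbar ≤ n) (i : Fin (J.p * J.sbar)) :
    (J.gR n i).1 = (i : ℕ) / J.sbar ∧
      (((J.gR n i).1 + 1 < J.p ∧ (J.gR n i).2 + 1 + (i : ℕ) % J.sbar = n) ∨
        ((J.gR n i).1 + 1 = J.p ∧ (J.gR n i).2 + 1 + (i : ℕ) % J.sbar = n + J.s)) := by
  have := index_bounds i
  rw [gR]
  split_ifs <;> dsimp only <;> omega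

theorem gR_injective {n : ℕ} (hn : J.sbar ≤ n) : Function.Injective (J.gR n) := by
  intro i j h
  have hi := gR_spec hn i
  have hj := gR_spec hn j
  rw [h] at hi
  have h1 : (i : ℕ) / J.sbar = (j : ℕ) / J.sbar := by omega
  have h2 : (i : ℕ) % J.sbar = (j : ℕ) % J.sbar := by omega
  exact Fin.ext (by rw [← Nat.div_add_mod (i : ℕ) J.sbar, h1, h2, Nat.div_add_mod])

theorem mem_rightVerts_iff {n : ℕ} (hn : J.sbar ≤ n) {x : ℕ × ℕ} :
    x ∈ J.rightVerts n ↔ ∃ i, J.gR n i = x := by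
  rw [mem_rightVerts, mem_latVerts]
  constructor
  · rintro ⟨h1, h2, h3⟩
    rcases Nat.lt_or_ge (x.1 + 1) J.p with h | h
    · obtain ⟨i, hi1, hi2⟩ := exists_index (J := J) (a := x.1) (b := n - 1 - x.2)
        (by omega) (by omega)
      have := gR_spec hn i
      exact ⟨i, Prod.ext (by omega) (by omega)⟩
    · obtain ⟨i, hi1, hi2⟩ := exists_index (J := J) (a := x.1) (b := n + J.s - 1 - x.2)
        (by omega) (by omega)
      have := gR_spec hn i
      exact ⟨i, Prod.ext (by omega) (by omega)⟩
  · rintro ⟨i, rfl⟩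
    have := gR_spec hn i
    have := index_bounds i
    omega

theorem gL_mem_latVerts {n : ℕ} (hn : J.sbar ≤ n) (i : Fin (J.p * J.sbar)) :
    J.gL i ∈ J.latVerts n :=
  leftVerts_subset_latVerts hn (mem_leftVerts_iff.2 ⟨i, rfl⟩)

theorem gR_mem_latVerts {n : ℕ} (hn : J.sbar ≤ n) (i : Fin (J.p * J.sbar)) :
    J.gR n i ∈ J.latVerts n :=
  (mem_rightVerts.1 ((mem_rightVerts_iff hn).2 ⟨i, rfl⟩)).1

theorem ite_eq_zero_val (a : Fin 2) : (if a = 0 then 0 else 1) = (a : ℕ) := by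
  revert a; decide

theorem clsIn_gL {n : ℕ} (hn : J.sbar ≤ n) (X : J.Cls) (i : Fin (J.p * J.sbar)) :
    J.clsIn n X (J.gL i) = X.1 i := by
  have h : (J.gL i ∉ J.latVerts n ∨ ∃ j, J.gL j = J.gL i ∧ X.1 j = 0) ↔ X.1 i = 0 := by
    constructor
    · rintro (h | ⟨j, hj, h⟩)
      · exact absurd (gL_mem_latVerts hn i) h
      · rwa [← gL_injective hj]
    · exact fun h => Or.inr ⟨i, rfl, h⟩
  rw [clsIn, ← ite_eq_zero_val]
  exact if_congr h rfl rfl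

theorem clsOut_gR {n : ℕ} (hn : J.sbar ≤ n) (X : J.Cls) (i : Fin (J.p * J.sbar)) :
    J.clsOut n X (J.gR n i) = X.2 i := by
  have h : (J.gR n i ∉ J.latVerts n ∨ ∃ j, J.gR n j = J.gR n i ∧ X.2 j = 0) ↔ X.2 i = 0 := by
    constructor
    · rintro (h | ⟨j, hj, h⟩)
      · exact absurd (gR_mem_latVerts hn i) h
      · rwa [← gR_injective hn hj]
    · exact fun h => Or.inr ⟨i, rfl, h⟩
  rw [clsOut, ← ite_eq_zero_val]
  exact if_congr h rfl rfl

theorem clsIn_of_notMem_leftVerts {n : ℕ} (X : J.Cls) {v : ℕ × ℕ} (hv : v ∈ J.latVerts n)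
    (hl : v ∉ J.leftVerts) : J.clsIn n X v = 1 := by
  refine if_neg ?_
  rintro (h | ⟨i, h, -⟩)
  · exact h hv
  · exact hl (mem_leftVerts_iff.2 ⟨i, h⟩)

theorem clsOut_of_notMem_rightVerts {n : ℕ} (hn : J.sbar ≤ n) (X : J.Cls) {v : ℕ × ℕ}
    (hv : v ∈ J.latVerts n) (hr : v ∉ J.rightVerts n) : J.clsOut n X v = 1 := by
  refine if_neg ?_
  rintro (h | ⟨i, h, -⟩)
  · exact h hv
  · exact hr ((mem_rightVerts_iff hn).2 ⟨i, h⟩)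

theorem clsIn_of_notMem_latVerts {n : ℕ} (X : J.Cls) {v : ℕ × ℕ} (hv : v ∉ J.latVerts n) :
    J.clsIn n X v = 0 := if_pos (Or.inl hv)

theorem clsOut_of_notMem_latVerts {n : ℕ} (X : J.Cls) {v : ℕ × ℕ} (hv : v ∉ J.latVerts n) :
    J.clsOut n X v = 0 := if_pos (Or.inl hv)

theorem clsIn_le_one (n : ℕ) (X : J.Cls) (v : ℕ × ℕ) : J.clsIn n X v ≤ 1 := by
  rw [clsIn]; split_ifs <;> omega

theorem clsOut_le_one (n : ℕ) (X : J.Cls) (v : ℕ × ℕ) : J.clsOut n X v ≤ 1 := by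
  rw [clsOut]; split_ifs <;> omega

/-- Legality fixes the degrees away from `L(n)` and `R(n)`, and `X` fixes them there. Being
classified thus becomes a pointwise identity of degrees, the form used from here on. -/
theorem classifiedAs_iff {n : ℕ} (hn : J.sbar ≤ n) {din dout : ℕ × ℕ → ℕ} {X : J.Cls} :
    J.ClassifiedAs n din dout X ↔
      ∀ v ∈ J.latVerts n, din v = J.clsIn n X v ∧ dout v = J.clsOut n X v := by
  constructor
  · rintro ⟨⟨-, h2, h3⟩, h4⟩ v hv
    constructor
    · by_cases hl : v ∈ J.leftVerts
      · obtain ⟨i, rfl⟩ := mem_leftVerts_iff.1 hl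
        rw [clsIn_gL hn, (h4 i).1]
      · rw [h2 v (Finset.mem_sdiff.2 ⟨hv, hl⟩), clsIn_of_notMem_leftVerts X hv hl]
    · by_cases hr : v ∈ J.rightVerts n
      · obtain ⟨i, rfl⟩ := (mem_rightVerts_iff hn).1 hr
        rw [clsOut_gR hn, (h4 i).2]
      · rw [h3 v (Finset.mem_sdiff.2 ⟨hv, hr⟩), clsOut_of_notMem_rightVerts hn X hv hr]
  · intro h
    refine ⟨⟨fun v hv => ?_, fun v hv => ?_, fun v hv => ?_⟩, fun i => ⟨?_, ?_⟩⟩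
    · rw [(h v hv).1, (h v hv).2]
      exact ⟨clsIn_le_one _ _ _, clsOut_le_one _ _ _⟩
    · rw [Finset.mem_sdiff] at hv
      rw [(h v hv.1).1, clsIn_of_notMem_leftVerts X hv.1 hv.2]
    · rw [Finset.mem_sdiff] at hv
      rw [(h v hv.1).2, clsOut_of_notMem_rightVerts hn X hv.1 hv.2]
    · rw [(h _ (gL_mem_latVerts hn i)).1, clsIn_gL hn]
    · rw [(h _ (gR_mem_latVerts hn i)).2, clsOut_gR hn]

theorem LegalDegrees.exists_classifiedAs {n : ℕ} (hn : J.sbar ≤ n) {din dout : ℕ × ℕ → ℕ}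
    (h : J.LegalDegrees n din dout) : ∃ X, J.ClassifiedAs n din dout X := by
  refine ⟨(fun i => ⟨din (J.gL i), ?_⟩, fun i => ⟨dout (J.gR n i), ?_⟩), h, fun i => ⟨rfl, rfl⟩⟩
  · have := (h.1 _ (gL_mem_latVerts hn i)).1
    omega
  · have := (h.1 _ (gR_mem_latVerts hn i)).2
    omega

theorem ClassifiedAs.unique {n : ℕ} {din dout : ℕ × ℕ → ℕ} {X Y : J.Cls}
    (hX : J.ClassifiedAs n din dout X) (hY : J.ClassifiedAs n din dout Y) : X = Y :=
  Prod.ext (funext fun i => Fin.ext ((hX.2 i).1.trans (hY.2 i).1.symm))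
    (funext fun i => Fin.ext ((hX.2 i).2.trans (hY.2 i).2.symm))

/-! ## Completions of a legal cover -/

/-- Outside `L_n` both sides vanish, so the identity holds at all points, in particular at the
vertices added in `L_{n+1}`. -/
theorem hasClass_iff {n : ℕ} (hn : J.sbar ≤ n) {T : Finset ((ℕ × ℕ) × (ℕ × ℕ))} {X : J.Cls} :
    J.HasClass n T X ↔ T ⊆ J.latEdges n ∧
      ∀ v, inDeg T v = J.clsIn n X v ∧ outDeg T v = J.clsOut n X v := by
  rw [HasClass, classifiedAs_iff hn]
  refine and_congr_right fun hT => ⟨fun h v => ?_, fun h v _ => h v⟩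
  by_cases hv : v ∈ J.latVerts n
  · exact h v hv
  · have hT' : ∀ e ∈ T, e.1 ∈ J.latVerts n ∧ e.2 ∈ J.latVerts n := fun e he =>
      Finset.mem_product.1 (Finset.mem_filter.1 (hT he)).1
    rw [clsIn_of_notMem_latVerts X hv, clsOut_of_notMem_latVerts X hv]
    exact ⟨inDeg_eq_zero fun e he h => hv (h ▸ (hT' e he).2),
      outDeg_eq_zero fun e he h => hv (h ▸ (hT' e he).1)⟩

theorem isCycleCover_union_iff {n : ℕ} (hn : J.sbar ≤ n) {X : J.Cls}
    {T S : Finset ((ℕ × ℕ) × (ℕ × ℕ))} (hT : J.HasClass n T X) (hS : S ⊆ J.hook n) :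
    IsCycleCover (J.latVerts n) (J.latCircEdges n) (T ∪ S) ↔ J.ClosesUp n X S := by
  rw [hasClass_iff hn] at hT
  have hd : Disjoint T S := Finset.disjoint_sdiff.mono hT.1 hS
  have hsub : T ∪ S ⊆ J.latCircEdges n := by
    rw [← latEdges_union_hook]
    exact Finset.union_subset_union hT.1 hS
  rw [IsCycleCover, ClosesUp, and_iff_right hsub]
  refine forall₂_congr fun v _ => ?_
  rw [inDeg_union hd, outDeg_union hd, (hT.2 v).1, (hT.2 v).2]

theorem hasClass_union_iff (hJ : J.Normalized) {n : ℕ} (hn : 2 * J.sbar ≤ n) {X Y : J.Cls}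
    {T S : Finset ((ℕ × ℕ) × (ℕ × ℕ))} (hT : J.HasClass n T X) (hS : S ⊆ J.newEdges n) :
    J.HasClass (n + 1) (T ∪ S) Y ↔ J.ExtendsTo n X S Y := by
  rw [hasClass_iff (by omega)] at hT
  have hd : Disjoint T S := Finset.disjoint_sdiff.mono hT.1 hS
  have hsub : T ∪ S ⊆ J.latEdges (n + 1) := by
    rw [← latEdges_union_newEdges hJ hn]
    exact Finset.union_subset_union hT.1 hS
  have h1 : inDeg (T ∪ S) = fun v => J.clsIn n X v + inDeg S v :=
    funext fun v => by rw [inDeg_union hd, (hT.2 v).1]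
  have h2 : outDeg (T ∪ S) = fun v => J.clsOut n X v + outDeg S v :=
    funext fun v => by rw [outDeg_union hd, (hT.2 v).2]
  rw [HasClass, ExtendsTo, and_iff_right hsub, h1, h2]

theorem exists_hasClass_of_isCycleCover_union (hJ : J.Normalized) {n : ℕ} (hn : 2 * J.sbar ≤ n)
    {T S : Finset ((ℕ × ℕ) × (ℕ × ℕ))} (hT : T ⊆ J.latEdges n) (hS : S ⊆ J.hook n)
    (h : IsCycleCover (J.latVerts n) (J.latCircEdges n) (T ∪ S)) : ∃ X, J.HasClass n T X := by
  have hd : Disjoint T S := Finset.disjoint_sdiff.mono hT hS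
  obtain ⟨-, h⟩ := h
  simp only [inDeg_union hd, outDeg_union hd] at h
  have hl : J.LegalDegrees n (inDeg T) (outDeg T) := by
    refine ⟨fun v hv => ?_, fun v hv => ?_, fun v hv => ?_⟩
    · have := h v hv
      omega
    · rw [Finset.mem_sdiff] at hv
      rw [← (h v hv.1).1, inDeg_eq_zero (S := S) (v := v) fun e he h' =>
        hv.2 (h' ▸ snd_mem_leftVerts_of_mem_hook hJ hn (hS he)), add_zero]
    · rw [Finset.mem_sdiff] at hv
      rw [← (h v hv.1).2, outDeg_eq_zero (S := S) (v := v) fun e he h' =>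
        hv.2 (h' ▸ fst_mem_rightVerts_of_mem_hook hJ hn (hS he)), add_zero]
  obtain ⟨X, hX⟩ := hl.exists_classifiedAs (by omega)
  exact ⟨X, hT, hX⟩

theorem inDeg_newEdges_eq_zero (hJ : J.Normalized) {n : ℕ} (hn : 2 * J.sbar ≤ n)
    {S : Finset ((ℕ × ℕ) × (ℕ × ℕ))} (hS : S ⊆ J.newEdges n) {v : ℕ × ℕ}
    (hv : v ∈ J.latVerts n) : inDeg S v = 0 :=
  inDeg_eq_zero fun _ he h => ((mem_newEdges hJ hn).1 (hS he)).2.1 (h ▸ hv)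

theorem exists_hasClass_of_hasClass_union (hJ : J.Normalized) {n : ℕ} (hn : 2 * J.sbar ≤ n)
    {T S : Finset ((ℕ × ℕ) × (ℕ × ℕ))} (hT : T ⊆ J.latEdges n) (hS : S ⊆ J.newEdges n)
    {Y : J.Cls} (h : J.HasClass (n + 1) (T ∪ S) Y) : ∃ X, J.HasClass n T X := by
  have hd : Disjoint T S := Finset.disjoint_sdiff.mono hT hS
  obtain ⟨-, ⟨h1, h2, h3⟩, -⟩ := h
  simp only [inDeg_union hd, outDeg_union hd] at h1 h2 h3
  have hl : J.LegalDegrees n (inDeg T) (outDeg T) := by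
    refine ⟨fun v hv => ?_, fun v hv => ?_, fun v hv => ?_⟩
    · have := h1 v (latVerts_subset_succ n hv)
      omega
    · rw [Finset.mem_sdiff] at hv
      rw [← h2 v (Finset.mem_sdiff.2 ⟨latVerts_subset_succ n hv.1, hv.2⟩),
        inDeg_newEdges_eq_zero hJ hn hS hv.1, add_zero]
    -- An old vertex outside `R(n)` is also outside `R(n + 1)`, and no new edge leaves it.
    · rw [Finset.mem_sdiff] at hv
      rw [← h3 v (Finset.mem_sdiff.2 ⟨latVerts_subset_succ n hv.1, fun hr => hv.2 ?_⟩),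
        outDeg_eq_zero (S := S) (v := v) fun e he h' =>
        hv.2 (h' ▸ fst_mem_rightVerts_of_mem_newEdges hJ hn (hS he) (h' ▸ hv.1)), add_zero]
      rw [mem_rightVerts] at hr ⊢
      exact ⟨hv.1, by omega⟩
  obtain ⟨X, hX⟩ := hl.exists_classifiedAs (by omega)
  exact ⟨X, hT, hX⟩

/-! ### Summation over classifications -/

theorem numCycleCovers_eq_sum (hJ : J.Normalized) {n : ℕ} (hn : 2 * J.sbar ≤ n) :
    J.numCycleCovers n = ∑ X, J.beta n X * J.numClass X n := by
  rw [numCycleCovers_eq hJ]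
  refine card_powerset_filter_union Finset.disjoint_sdiff (latEdges_union_hook n)
    (fun X Y T hX hY => hX.2.unique hY.2) fun T hT S hS => ⟨fun h => ?_, ?_⟩
  · obtain ⟨X, hX⟩ := exists_hasClass_of_isCycleCover_union hJ hn hT hS h
    exact ⟨X, hX, (isCycleCover_union_iff (by omega) hX hS).1 h⟩
  · rintro ⟨X, hX, h⟩
    exact (isCycleCover_union_iff (by omega) hX hS).2 h

theorem numClass_succ (hJ : J.Normalized) {n : ℕ} (hn : 2 * J.sbar ≤ n) (Y : J.Cls) :
    J.numClass Y (n + 1) = ∑ X, J.alpha n Y X * J.numClass X n := by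
  refine card_powerset_filter_union (Q := fun X T => J.HasClass n T X)
    (R := fun X S => J.ExtendsTo n X S Y) Finset.disjoint_sdiff (latEdges_union_newEdges hJ hn)
    (fun X Y T hX hY => hX.2.unique hY.2) fun T hT S hS => ⟨fun h => ?_, ?_⟩
  · obtain ⟨X, hX⟩ := exists_hasClass_of_hasClass_union hJ hn hT hS h
    exact ⟨X, hX, (hasClass_union_iff hJ hn hX hS).1 h⟩
  · rintro ⟨X, hX, h⟩
    exact (hasClass_union_iff hJ hn hX hS).2 h

/-! ## Independence of `n` -/

/-- The lattice vertex to the right of `x`. -/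
def shift (x : ℕ × ℕ) : ℕ × ℕ := (x.1, x.2 + 1)

theorem shift_injective : Function.Injective shift := fun x y h => by
  rw [shift, shift, Prod.mk.injEq, Nat.add_right_cancel_iff] at h
  exact Prod.ext h.1 h.2

theorem exists_shift_eq {x : ℕ × ℕ} (hx : 0 < x.2) : ∃ y, shift y = x :=
  ⟨(x.1, x.2 - 1), Prod.ext rfl (Nat.succ_pred_eq_of_pos hx)⟩

theorem shift_mem_latVerts {n : ℕ} {x : ℕ × ℕ} :
    shift x ∈ J.latVerts (n + 1) ↔ x ∈ J.latVerts n := by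
  rw [mem_latVerts, mem_latVerts, shift]
  omega

theorem isLocalStep_shift {x y : ℕ × ℕ} :
    J.IsLocalStep (shift x) (shift y) ↔ J.IsLocalStep x y := by
  refine exists_congr fun i => ?_
  simp only [shift]
  omega

theorem isHookStep_shift {n : ℕ} {x y : ℕ × ℕ} :
    J.IsHookStep (n + 1) (shift x) y ↔ J.IsHookStep n x y := by
  refine exists_congr fun i => ?_
  simp only [shift]
  omega

theorem gR_succ {n : ℕ} (hn : J.sbar ≤ n) (i : Fin (J.p * J.sbar)) :
    J.gR (n + 1) i = shift (J.gR n i) := by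
  have h1 := gR_spec hn i
  have h2 := gR_spec (show J.sbar ≤ n + 1 by omega) i
  exact Prod.ext (by rw [shift]; omega) (by rw [shift]; dsimp only; omega)

theorem clsOut_shift {n : ℕ} (hn : J.sbar ≤ n) (X : J.Cls) (v : ℕ × ℕ) :
    J.clsOut (n + 1) X (shift v) = J.clsOut n X v := by
  refine if_congr (or_congr (not_congr shift_mem_latVerts) (exists_congr fun i => ?_)) rfl rfl
  rw [gR_succ hn, shift_injective.eq_iff]

theorem image_hook (hJ : J.Normalized) {n : ℕ} (hn : 2 * J.sbar ≤ n) :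
    (J.hook n).image (Prod.map shift id) = J.hook (n + 1) := by
  ext ⟨x, y⟩
  rw [Finset.mem_image]
  constructor
  · rintro ⟨⟨a, b⟩, h, he⟩
    rw [Prod.map_apply, Prod.mk.injEq] at he
    obtain ⟨rfl, rfl⟩ := he
    rw [mem_hook hJ hn] at h
    rw [mem_hook hJ (hn.trans n.le_succ)]
    exact ⟨⟨shift_mem_latVerts.2 h.1.1, latVerts_subset_succ n h.1.2⟩, isHookStep_shift.2 h.2⟩
  · intro h
    have hl := leftVerts_subset_latVerts (n := n) (by omega)
      (snd_mem_leftVerts_of_mem_hook hJ (hn.trans n.le_succ) h)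
    rw [mem_hook hJ (hn.trans n.le_succ)] at h
    obtain ⟨⟨h1, h2⟩, h3⟩ := h
    -- The source of a hook edge is within `s̄` of the end of its row, hence not in column 0 and in
    -- the image of `shift`.
    have hx : 0 < x.2 := by
      obtain ⟨i, hi⟩ := h3
      have := sj_le_sbar i
      dsimp only at hi
      omega
    obtain ⟨z, rfl⟩ := exists_shift_eq hx
    exact ⟨(z, y), (mem_hook hJ hn).2 ⟨⟨shift_mem_latVerts.1 h1, hl⟩, isHookStep_shift.1 h3⟩, rfl⟩

theorem image_newEdges (hJ : J.Normalized) {n : ℕ} (hn : 2 * J.sbar ≤ n) :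
    (J.newEdges n).image (Prod.map shift shift) = J.newEdges (n + 1) := by
  ext ⟨x, y⟩
  rw [Finset.mem_image]
  constructor
  · rintro ⟨⟨a, b⟩, h, he⟩
    rw [Prod.map_apply, Prod.mk.injEq] at he
    obtain ⟨rfl, rfl⟩ := he
    rw [mem_newEdges hJ hn] at h
    rw [mem_newEdges hJ (hn.trans n.le_succ)]
    exact ⟨⟨shift_mem_latVerts.2 h.1.1, shift_mem_latVerts.2 h.1.2⟩,
      fun h' => h.2.1 (shift_mem_latVerts.1 h'), isLocalStep_shift.2 h.2.2⟩
  · intro h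
    rw [mem_newEdges hJ (hn.trans n.le_succ)] at h
    obtain ⟨⟨h1, h2⟩, h3, h4⟩ := h
    have hxy : 0 < x.2 ∧ 0 < y.2 := by
      obtain ⟨i, hi⟩ := h4
      have := sj_le_sbar i
      rw [mem_latVerts] at h1 h2 h3
      dsimp only at hi h1 h2 h3
      omega
    obtain ⟨z, rfl⟩ := exists_shift_eq hxy.1
    obtain ⟨w, rfl⟩ := exists_shift_eq hxy.2
    exact ⟨(z, w), (mem_newEdges hJ hn).2 ⟨⟨shift_mem_latVerts.1 h1, shift_mem_latVerts.1 h2⟩,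
      fun h' => h3 (shift_mem_latVerts.2 h'), isLocalStep_shift.1 h4⟩, rfl⟩

/-- Away from `L(n)` and `R(n)` the relevant degrees are already 1 and `S` adds nothing. The
remaining conditions are indexed by `i`, a set that does not grow with `n`. -/
theorem closesUp_iff (hJ : J.Normalized) {n : ℕ} (hn : 2 * J.sbar ≤ n) {X : J.Cls}
    {S : Finset ((ℕ × ℕ) × (ℕ × ℕ))} (hS : S ⊆ J.hook n) :
    J.ClosesUp n X S ↔
      ∀ i, X.1 i + inDeg S (J.gL i) = 1 ∧ X.2 i + outDeg S (J.gR n i) = 1 := by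
  have hn' : J.sbar ≤ n := by omega
  constructor
  · intro h i
    have h1 := (h _ (gL_mem_latVerts hn' i)).1
    have h2 := (h _ (gR_mem_latVerts hn' i)).2
    rw [clsIn_gL hn'] at h1
    rw [clsOut_gR hn'] at h2
    exact ⟨h1, h2⟩
  · intro h v hv
    constructor
    · by_cases hl : v ∈ J.leftVerts
      · obtain ⟨i, rfl⟩ := mem_leftVerts_iff.1 hl
        rw [clsIn_gL hn', (h i).1]
      · rw [clsIn_of_notMem_leftVerts X hv hl, inDeg_eq_zero (v := v) fun e he h' =>
          hl (h' ▸ snd_mem_leftVerts_of_mem_hook hJ hn (hS he))]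
    · by_cases hr : v ∈ J.rightVerts n
      · obtain ⟨i, rfl⟩ := (mem_rightVerts_iff hn').1 hr
        rw [clsOut_gR hn', (h i).2]
      · rw [clsOut_of_notMem_rightVerts hn' X hv hr, outDeg_eq_zero (v := v) fun e he h' =>
          hr (h' ▸ fst_mem_rightVerts_of_mem_hook hJ hn (hS he))]

/-- Sources of hook edges lie in `R(n)`, which moves with `n`, and targets in `L(n)`, which does
not; so only the sources are shifted. -/
theorem beta_succ (hJ : J.Normalized) {n : ℕ} (hn : 2 * J.sbar ≤ n) (X : J.Cls) :
    J.beta (n + 1) X = J.beta n X := by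
  have hinj : Function.Injective (Prod.map shift (id : ℕ × ℕ → ℕ × ℕ)) :=
    shift_injective.prodMap Function.injective_id
  refine (card_powerset_filter_image hinj.injOn (image_hook hJ hn) fun S hS => ?_).symm
  have hS' : S.image (Prod.map shift id) ⊆ J.hook (n + 1) := by
    rw [← image_hook hJ hn]
    exact Finset.image_subset_image hS
  rw [closesUp_iff hJ hn hS, closesUp_iff hJ (hn.trans n.le_succ) hS']
  refine forall_congr' fun i => ?_
  rw [gR_succ (by omega), inDeg_image hinj.injOn (v := J.gL i) fun e _ => Iff.rfl,
    outDeg_image hinj.injOn fun e _ => shift_injective.eq_iff]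

/-- New edges end in new vertices, which lie outside `L(n)`, so indegrees on `L(n)` are inherited.
The left components enter only through their equality; this yields the block structure. -/
theorem extendsTo_iff (hJ : J.Normalized) {n : ℕ} (hn : 2 * J.sbar ≤ n) {X X' : J.Cls}
    {S : Finset ((ℕ × ℕ) × (ℕ × ℕ))} (hS : S ⊆ J.newEdges n) :
    J.ExtendsTo n X' S X ↔ X.1 = X'.1 ∧
      (∀ v ∈ J.latVerts (n + 1), v ∉ J.latVerts n → inDeg S v = 1) ∧
      ∀ v ∈ J.latVerts (n + 1), J.clsOut n X' v + outDeg S v = J.clsOut (n + 1) X v := by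
  have hn' : J.sbar ≤ n := by omega
  have hn1 : J.sbar ≤ n + 1 := by omega
  rw [ExtendsTo, classifiedAs_iff hn1]
  constructor
  · intro h
    refine ⟨funext fun i => Fin.ext ?_, fun v hv hv' => ?_, fun v hv => (h v hv).2⟩
    · have := (h _ (gL_mem_latVerts hn1 i)).1
      rw [clsIn_gL hn', clsIn_gL hn1,
        inDeg_newEdges_eq_zero hJ hn hS (gL_mem_latVerts hn' i), add_zero] at this
      exact this.symm
    · have := (h v hv).1
      rwa [clsIn_of_notMem_latVerts X' hv', zero_add, clsIn_of_notMem_leftVerts X hv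
        fun hl => hv' (leftVerts_subset_latVerts hn' hl)] at this
  · rintro ⟨h1, h2, h3⟩ v hv
    refine ⟨?_, h3 v hv⟩
    by_cases hv' : v ∈ J.latVerts n
    · rw [inDeg_newEdges_eq_zero hJ hn hS hv', add_zero]
      by_cases hl : v ∈ J.leftVerts
      · obtain ⟨i, rfl⟩ := mem_leftVerts_iff.1 hl
        rw [clsIn_gL hn', clsIn_gL hn1, h1]
      · rw [clsIn_of_notMem_leftVerts X hv hl, clsIn_of_notMem_leftVerts X' hv' hl]
    · rw [clsIn_of_notMem_latVerts X' hv', h2 v hv hv', clsIn_of_notMem_leftVerts X hv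
        fun hl => hv' (leftVerts_subset_latVerts hn' hl)]

theorem alpha_succ (hJ : J.Normalized) {n : ℕ} (hn : 2 * J.sbar ≤ n) (X X' : J.Cls) :
    J.alpha (n + 1) X X' = J.alpha n X X' := by
  have hinj : Function.Injective (Prod.map shift shift) :=
    shift_injective.prodMap shift_injective
  refine (card_powerset_filter_image hinj.injOn (image_newEdges hJ hn) fun S hS => ?_).symm
  have hS' : S.image (Prod.map shift shift) ⊆ J.newEdges (n + 1) := by
    rw [← image_newEdges hJ hn]
    exact Finset.image_subset_image hS
  have hin : ∀ v, inDeg (S.image (Prod.map shift shift)) (shift v) = inDeg S v := fun v =>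
    inDeg_image hinj.injOn fun e _ => shift_injective.eq_iff
  have hout : ∀ v, outDeg (S.image (Prod.map shift shift)) (shift v) = outDeg S v := fun v =>
    outDeg_image hinj.injOn fun e _ => shift_injective.eq_iff
  rw [extendsTo_iff hJ hn hS, extendsTo_iff hJ (hn.trans n.le_succ) hS']
  refine and_congr_right fun _ => and_congr ⟨fun h v hv hv' => ?_, fun h v hv hv' => ?_⟩
    ⟨fun h v hv => ?_, fun h v hv => ?_⟩
  · have hpos : 0 < v.2 := by
      rw [mem_latVerts] at hv hv'
      omega
    obtain ⟨w, rfl⟩ := exists_shift_eq hpos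
    rw [hin]
    exact h w (shift_mem_latVerts.1 hv) fun h' => hv' (shift_mem_latVerts.2 h')
  · rw [← hin]
    exact h _ (shift_mem_latVerts.2 hv) fun h' => hv' (shift_mem_latVerts.1 h')
  -- Column 0 is not in the image of `shift`. There both prescribed outdegrees are 1, since these
  -- vertices are too far from the right ends, and a shifted edge never starts there.
  · rcases Nat.eq_zero_or_pos v.2 with h0 | hpos
    · have hs := hJ.s_le_sbar
      have hv1 : v ∈ J.latVerts (n + 1) := by
        rw [mem_latVerts] at hv ⊢
        omega
      rw [clsOut_of_notMem_rightVerts (by omega) X' hv1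
          (by rw [mem_rightVerts, mem_latVerts]; omega),
        clsOut_of_notMem_rightVerts (by omega) X hv (by rw [mem_rightVerts, mem_latVerts]; omega),
        outDeg_eq_zero]
      intro e he he'
      obtain ⟨f, -, rfl⟩ := Finset.mem_image.1 he
      rw [← he'] at h0
      exact Nat.succ_ne_zero _ h0
    · obtain ⟨w, rfl⟩ := exists_shift_eq hpos
      rw [hout, clsOut_shift (by omega), clsOut_shift (by omega)]
      exact h w (shift_mem_latVerts.1 hv)
  · rw [← hout, ← clsOut_shift (by omega) X', ← clsOut_shift (by omega) X]
    exact h _ (shift_mem_latVerts.2 hv)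

theorem beta_eq_betaVec (hJ : J.Normalized) {n : ℕ} (hn : 2 * J.sbar ≤ n) (X : J.Cls) :
    (J.beta n X : ℤ) = J.betaVec X := by
  rw [betaVec]
  congr 1
  induction n, hn using Nat.le_induction with
  | base => rfl
  | succ n hn ih => rw [beta_succ hJ hn, ih]

theorem alpha_eq_transferMatrix (hJ : J.Normalized) {n : ℕ} (hn : 2 * J.sbar ≤ n)
    (X X' : J.Cls) : (J.alpha n X X' : ℤ) = J.transferMatrix X X' := by
  rw [transferMatrix, Matrix.of_apply]
  congr 1
  induction n, hn using Nat.le_induction with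
  | base => rfl
  | succ n hn ih => rw [alpha_succ hJ hn, ih]

theorem numCycleCovers_eq_dotProduct (hJ : J.Normalized) {n : ℕ} (hn : 2 * J.sbar ≤ n) :
    (J.numCycleCovers n : ℤ) = J.betaVec ⬝ᵥ J.classVec n := by
  rw [numCycleCovers_eq_sum hJ hn, dotProduct]
  push_cast
  exact Finset.sum_congr rfl fun X _ => by rw [beta_eq_betaVec hJ hn, classVec]

theorem classVec_succ (hJ : J.Normalized) {n : ℕ} (hn : 2 * J.sbar ≤ n) :
    J.classVec (n + 1) = J.transferMatrix *ᵥ J.classVec n := by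
  funext Y
  rw [classVec, numClass_succ hJ hn, Matrix.mulVec, dotProduct]
  push_cast
  exact Finset.sum_congr rfl fun X _ => by rw [alpha_eq_transferMatrix hJ hn, classVec]

/-! ## The block structure of the transfer matrix -/

/-- The block of the transfer matrix on the classifications with a given left component. -/
noncomputable def transferBlock (J : LinearJumps) : Matrix J.Tuple J.Tuple ℤ :=
  Matrix.of fun R R' => J.transferMatrix (0, R) (0, R')

/-- Both cases come from `extendsTo_iff`. The choice of left component `0` in `transferBlock` is
immaterial, since the other conditions do not see it. -/
theorem transferMatrix_apply (hJ : J.Normalized) (L L' R R' : J.Tuple) :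
    J.transferMatrix (L, R) (L', R') = if L = L' then J.transferBlock R R' else 0 := by
  classical
  split_ifs with h
  · subst h
    rw [transferBlock, Matrix.of_apply, transferMatrix, Matrix.of_apply, Matrix.of_apply]
    refine congrArg _ (congrArg _ (Finset.filter_congr fun S hS => ?_))
    rw [Finset.mem_powerset] at hS
    rw [extendsTo_iff hJ le_rfl hS, extendsTo_iff hJ le_rfl hS]
    exact and_congr (iff_of_true rfl rfl) Iff.rfl
  · rw [transferMatrix, Matrix.of_apply, Nat.cast_eq_zero, alpha, Finset.card_eq_zero,
      Finset.filter_eq_empty_iff]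
    intro S hS hE
    rw [Finset.mem_powerset] at hS
    exact h ((extendsTo_iff hJ le_rfl hS).1 hE).1

/-! ### Consistent orders and the block diagonal form -/

theorem card_tuple : Fintype.card J.Tuple = 2 ^ (J.p * J.sbar) := by
  rw [Fintype.card_fun, Fintype.card_fin, Fintype.card_fin]

/-- A strict linear order on a finite type is the order of an enumeration. -/
theorem exists_enumeration {α : Type*} [Fintype α] {m : ℕ} (hm : Fintype.card α = m)
    (r : α → α → Prop) (hr : IsStrictTotalOrder α r) :
    ∃ f : α ≃ Fin m, ∀ a b, f a < f b ↔ r a b := by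
  classical
  let _ : LinearOrder α := linearOrderOfSTO r
  exact ⟨(Fintype.orderIsoFinOfCardEq α hm).symm.toEquiv,
    fun a b => (Fintype.orderIsoFinOfCardEq α hm).symm.lt_iff_lt⟩

/-- An enumeration is determined by its order. -/
theorem enumeration_unique {α : Type*} {m : ℕ} (f g : α ≃ Fin m)
    (h : ∀ a b, f a < f b ↔ g a < g b) : f = g := by
  let φ : Fin m ≃o Fin m :=
    { toEquiv := f.symm.trans g
      map_rel_iff' := fun {a b} => by
        have := h (f.symm b) (f.symm a)
        rw [f.apply_symm_apply, f.apply_symm_apply] at this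
        rw [Equiv.trans_apply, Equiv.trans_apply, ← not_lt, ← not_lt, this] }
  have hφ : φ = OrderIso.refl _ := Subsingleton.elim _ _
  refine Equiv.ext fun a => ?_
  have := congrArg (fun ψ : Fin m ≃o Fin m => ψ (f a)) hφ
  have h2 : g (f.symm (f a)) = f a := this
  rw [f.symm_apply_apply] at h2
  exact h2.symm

theorem finProdFinEquiv_lt_iff {m n : ℕ} (a b : Fin m × Fin n) :
    finProdFinEquiv a < finProdFinEquiv b ↔ a.1 < b.1 ∨ a.1 = b.1 ∧ a.2 < b.2 := by
  have key : ∀ c d : Fin m × Fin n, c.1 < d.1 → finProdFinEquiv c < finProdFinEquiv d := by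
    intro c d h
    rw [Fin.lt_def, finProdFinEquiv_apply_val, finProdFinEquiv_apply_val]
    have h1 := Nat.mul_le_mul_left n (Nat.succ_le_of_lt (Fin.lt_def.1 h))
    rw [Nat.mul_succ] at h1
    have := c.2.2
    omega
  rcases lt_trichotomy a.1 b.1 with h | h | h
  · exact iff_of_true (key a b h) (Or.inl h)
  · rw [Fin.lt_def, finProdFinEquiv_apply_val, finProdFinEquiv_apply_val, h]
    simp
  · refine iff_of_false (key b a h).not_gt ?_
    rintro (h' | ⟨h', -⟩)
    · exact h.not_gt h'
    · exact h.ne' h'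

theorem exists_reindex_eq_blockDiagonal (hJ : J.Normalized) {lt : J.Cls → J.Cls → Prop}
    (hlt : J.Consistent lt) (e : J.Cls ≃ Fin (2 ^ (J.p * J.sbar) * 2 ^ (J.p * J.sbar)))
    (he : ∀ X₁ X₂ : J.Cls, e X₁ < e X₂ ↔ lt X₁ X₂) :
    ∃ Abar : Matrix (Fin (2 ^ (J.p * J.sbar))) (Fin (2 ^ (J.p * J.sbar))) ℤ,
      Matrix.reindex e e J.transferMatrix =
        Matrix.reindex ((Equiv.prodComm _ _).trans finProdFinEquiv)
          ((Equiv.prodComm _ _).trans finProdFinEquiv)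
          (Matrix.blockDiagonal fun _ : Fin (2 ^ (J.p * J.sbar)) => Abar) := by
  obtain ⟨ltL, ltR, hL, hR, h⟩ := hlt
  obtain ⟨eL, heL⟩ := exists_enumeration card_tuple ltL hL
  obtain ⟨eR, heR⟩ := exists_enumeration card_tuple ltR hR
  -- `finProdFinEquiv` is lexicographic, so both enumerations induce the order `lt` and must agree.
  -- The `prodComm` in the goal appears because `Matrix.blockDiagonal` puts the block index second.
  have hee : e = (Equiv.prodCongr eL eR).trans finProdFinEquiv := by
    refine enumeration_unique _ _ fun X Y => ?_
    rw [he, h, Equiv.trans_apply, Equiv.trans_apply, finProdFinEquiv_lt_iff]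
    simp [heL, heR]
  refine ⟨Matrix.reindex eR eR J.transferBlock, ?_⟩
  subst hee
  ext x y
  obtain ⟨⟨a, b⟩, rfl⟩ := finProdFinEquiv.surjective x
  obtain ⟨⟨a', b'⟩, rfl⟩ := finProdFinEquiv.surjective y
  simp [Matrix.blockDiagonal_apply, transferMatrix_apply hJ]

/-! ## The recurrence -/

/-- The full transfer matrix would only give order `4^(p s̄)`. Each slice of `classVec` with fixed
left component is driven by the same block, so the characteristic polynomial of that block
annihilates all slices at once. -/
theorem exists_linearRecurrence (hJ : J.Normalized) :
    ∃ E : LinearRecurrence ℤ, E.order ≤ 2 ^ (J.p * J.sbar) ∧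
      E.IsSolution fun n : ℕ => (J.numCycleCovers (2 * J.sbar + n) : ℤ) := by
  classical
  have hw : ∀ (L : J.Tuple) (n : ℕ), (fun R => J.classVec (2 * J.sbar + (n + 1)) (L, R)) =
      J.transferBlock *ᵥ fun R => J.classVec (2 * J.sbar + n) (L, R) := by
    intro L n
    funext R
    rw [← add_assoc, classVec_succ hJ (Nat.le_add_right _ _), Matrix.mulVec, dotProduct,
      Fintype.sum_prod_type, Finset.sum_eq_single L]
    · simp only [transferMatrix_apply hJ, if_true]
      rfl
    · intro L' _ hL'
      simp only [transferMatrix_apply hJ, if_neg hL'.symm, zero_mul, Finset.sum_const_zero]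
    · exact fun h => absurd (Finset.mem_univ _) h
  refine ⟨⟨2 ^ (J.p * J.sbar), fun i => -J.transferBlock.charpoly.coeff i⟩, le_rfl, fun n => ?_⟩
  have hz : ∑ i ∈ Finset.range (2 ^ (J.p * J.sbar) + 1), J.transferBlock.charpoly.coeff i *
      (J.numCycleCovers (2 * J.sbar + (n + i)) : ℤ) = 0 := by
    have hc : ∀ L R, ∑ i ∈ Finset.range (2 ^ (J.p * J.sbar) + 1),
        J.transferBlock.charpoly.coeff i * J.classVec (2 * J.sbar + (n + i)) (L, R) = 0 := by
      intro L R
      have := congrFun (sum_charpoly_coeff_smul_eq_zero J.transferBlock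
        (fun n R => J.classVec (2 * J.sbar + n) (L, R)) (hw L) n) R
      rw [card_tuple] at this
      simpa using this
    simp only [numCycleCovers_eq_dotProduct hJ (Nat.le_add_right _ _), dotProduct,
      Finset.mul_sum]
    rw [Finset.sum_comm]
    refine Finset.sum_eq_zero fun X _ => ?_
    simp only [mul_left_comm _ (J.betaVec X)]
    rw [← Finset.mul_sum, hc X.1 X.2, mul_zero]
  -- Monicity allows solving for the top term with integer coefficients.
  have hlead : J.transferBlock.charpoly.coeff (2 ^ (J.p * J.sbar)) = 1 := by
    rw [← card_tuple, ← Matrix.charpoly_natDegree_eq_dim J.transferBlock]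
    exact (Matrix.charpoly_monic _).coeff_natDegree
  rw [Finset.sum_range_succ, hlead, one_mul] at hz
  simp only [neg_mul, Finset.sum_neg_distrib]
  rw [Fin.sum_univ_eq_sum_range (fun i => J.transferBlock.charpoly.coeff i *
    (J.numCycleCovers (2 * J.sbar + (n + i)) : ℤ))]
  exact eq_neg_of_add_eq_zero_right hz

end LinearJumps

theorem mainTheorem4 (J : LinearJumps) (hJ : J.Normalized) :
    -- the number of cycle covers is the permanent
    (∀ n : ℕ, J.numCycleCovers n = (J.circMatrix n).permanent) ∧
    -- the coefficients do not depend on the value of `n`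
    (∀ n : ℕ, 2 * J.sbar ≤ n → ∀ X : J.Cls,
      (J.beta n X : ℤ) = J.betaVec X ∧
      ∀ X' : J.Cls, (J.alpha n X X' : ℤ) = J.transferMatrix X X') ∧
    -- they count completions of any actual legal cover with the given classification
    (∀ n : ℕ, 2 * J.sbar ≤ n → ∀ (X : J.Cls) (T : Finset ((ℕ × ℕ) × (ℕ × ℕ))),
      J.HasClass n T X →
        (∀ S ⊆ J.hook n,
          IsCycleCover (J.latVerts n) (J.latCircEdges n) (T ∪ S) ↔ J.ClosesUp n X S) ∧
        (∀ S ⊆ J.newEdges n, ∀ Y : J.Cls,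
          J.HasClass (n + 1) (T ∪ S) Y ↔ J.ExtendsTo n X S Y)) ∧
    -- the transfer-matrix recursion
    (∀ n : ℕ, 2 * J.sbar ≤ n →
      (J.numCycleCovers n : ℤ) = J.betaVec ⬝ᵥ J.classVec n ∧
      J.classVec (n + 1) = J.transferMatrix *ᵥ J.classVec n) ∧
    -- in every consistent order the transfer matrix is `diag(Ā, …, Ā)`
    (∀ lt : J.Cls → J.Cls → Prop, J.Consistent lt →
      ∀ e : J.Cls ≃ Fin (2 ^ (J.p * J.sbar) * 2 ^ (J.p * J.sbar)),
        (∀ X₁ X₂ : J.Cls, e X₁ < e X₂ ↔ lt X₁ X₂) →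
        ∃ Abar : Matrix (Fin (2 ^ (J.p * J.sbar))) (Fin (2 ^ (J.p * J.sbar))) ℤ,
          Matrix.reindex e e J.transferMatrix =
            Matrix.reindex ((Equiv.prodComm _ _).trans finProdFinEquiv)
              ((Equiv.prodComm _ _).trans finProdFinEquiv)
              (Matrix.blockDiagonal fun _ : Fin (2 ^ (J.p * J.sbar)) => Abar)) ∧
    -- the recurrence for the number of cycle covers
    (∃ E : LinearRecurrence ℤ, E.order ≤ 2 ^ (J.p * J.sbar) ∧
      E.IsSolution fun n : ℕ => (J.numCycleCovers (2 * J.sbar + n) : ℤ)) := by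
  exact ⟨LinearJumps.numCycleCovers_eq_permanent,
    fun n hn X => ⟨LinearJumps.beta_eq_betaVec hJ hn X,
      fun X' => LinearJumps.alpha_eq_transferMatrix hJ hn X X'⟩,
    fun n hn X T hT => ⟨fun S hS => LinearJumps.isCycleCover_union_iff (by omega) hT hS,
      fun S hS Y => LinearJumps.hasClass_union_iff hJ hn hT hS⟩,
    fun n hn => ⟨LinearJumps.numCycleCovers_eq_dotProduct hJ hn, LinearJumps.classVec_succ hJ hn⟩,
    fun lt hlt e he => LinearJumps.exists_reindex_eq_blockDiagonal hJ hlt e he,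
    LinearJumps.exists_linearRecurrence hJ⟩
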